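/- Let $n\ge 1$ and let $M$ be a non-empty smooth manifold of dimension $2n+1$ with a Riemannian metric $g$, Levi-Civita connection $\nabla$ and curvature tensor $R_{X,Y}Z=\nabla_X\nabla_YZ-\nabla_Y\nabla_XZ-\nabla_{[X,Y]}Z$. Let $(f,Q,\xi,\eta)$ be a \emph{weak almost contact metric structure} on $(M,g)$: $f$ is a smooth $(1,1)$-tensor of rank $2n$, $Q$ is a smooth nonsingular $(1,1)$-tensor, $\xi$ is a smooth vector field and $\eta$ is a smooth $1$-form such that $$f^2=-Q+\eta\otimes\xi,\qquad \eta(\xi)=1,\qquad Q\,\xi=\xi,\qquad g(fX,fY)=g(X,QY)-\eta(X)\,\eta(Y)$$ for all vector fields $X,Y$, and the distribution $\ker\eta$ is $f$-invariant. Suppose that it is a \emph{weak $\beta$-Kenmotsu} structure with a constant $\beta\in\mathbb{R}$, $\beta\neq 0$, that is, $$(\nabla_Xf)Y=\beta\{g(fX,Y)\,\xi-\eta(Y)\,fX\}$$ for all smooth vector fields $X,Y$. Let $$\operatorname{Ric}^\ast(X,Y)=\tfrac12\operatorname{trace}\{Z\mapsto R_{X,fY}\,fZ\}$$ be the $\ast$-Ricci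 tensor, and let $V$ be a smooth vector field and $\lambda,\mu\in\mathbb{R}$ constants such that $(g,V)$ is a \emph{$\ast$-$\eta$-Ricci soliton}: $$\tfrac12\,\pounds_V g+\operatorname{Ric}^\ast=\lambda\,g+\mu\,\eta\otimes\eta .$$ The soliton is called \emph{shrinking}, \emph{steady} or \emph{expanding} if $\lambda$ is positive, zero or negative, respectively. Then $$(\pounds_V\,\eta)(\xi)=\eta(\pounds_V\,\xi)=0\quad\text{on } M,\qquad \lambda+\mu=0 .$$ Consequently, the soliton is shrinking, steady or expanding if and only if $\mu$ is negative, zero or positive, respectively. -/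

import Mathlib

open Bundle Manifold VectorField
open scoped ContDiff

noncomputable section

namespace WeakKenmotsu

/-! Conventions.  `M` is a smooth manifold modelled on `(E, H)` through `I`, and its Riemannian
metric `g` is given by the inner products `inner ℝ u v` on the tangent spaces. A vector field is a
function `X : ∀ x : M, TangentSpace I x`. -/

instance finiteDimensional_tangentSpace {E : Type*} [NormedAddCommGroup E] [NormedSpace ℝ E]
    [FiniteDimensional ℝ E] {H : Type*} [TopologicalSpace H] (I : ModelWithCorners ℝ E H)
    {M : Type*} [TopologicalSpace M] [ChartedSpace H M] (x : M) :
    FiniteDimensional ℝ (TangentSpace I x) :=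
  inferInstanceAs (FiniteDimensional ℝ E)

section LeviCivita

set_option linter.unusedSectionVars false

variable {E : Type*} [NormedAddCommGroup E] [NormedSpace ℝ E] [FiniteDimensional ℝ E]
  {H : Type*} [TopologicalSpace H] (I : ModelWithCorners ℝ E H)
  {M : Type*} [TopologicalSpace M] [ChartedSpace H M] [IsManifold I ∞ M]
  [RiemannianBundle (fun x : M => TangentSpace I x)]

/-- The function `g(X, Y)`. -/
def metricFn (X Y : ∀ x : M, TangentSpace I x) : M → ℝ :=
  fun x => inner ℝ (X x) (Y x)

/-- The right-hand side of the Koszul formula for `g(∇_U Y, W)`: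
`½ (U g(Y,W) + Y g(U,W) - W g(U,Y) + g([U,Y],W) - g([U,W],Y) - g([Y,W],U))`. -/
def koszul (Y U W : ∀ x : M, TangentSpace I x) (x : M) : ℝ :=
  (1 / 2) * (mvfderiv I (metricFn I Y W) x (U x) + mvfderiv I (metricFn I U W) x (Y x)
    - mvfderiv I (metricFn I U Y) x (W x)
    + inner ℝ (mlieBracket I U Y x) (W x) - inner ℝ (mlieBracket I U W x) (Y x)
    - inner ℝ (mlieBracket I Y W x) (U x))

variable [IsContMDiffRiemannianBundle I ∞ E (fun x : M => TangentSpace I x)]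

variable {I} in
theorem mdifferentiableAt_metricFn {X Y : ∀ x : M, TangentSpace I x} {x : M}
    (hX : MDiffAt (T% X) x) (hY : MDiffAt (T% Y) x) :
    MDiffAt (metricFn I X Y) x :=
  MDifferentiableAt.inner_bundle hX hY

theorem metricFn_comm (X Y : ∀ x : M, TangentSpace I x) : metricFn I X Y = metricFn I Y X := by
  funext x; exact real_inner_comm _ _

theorem metricFn_add_left (X X' Y : ∀ x : M, TangentSpace I x) :
    metricFn I (X + X') Y = metricFn I X Y + metricFn I X' Y := by
  funext x; exact inner_add_left _ _ _

theorem metricFn_smul_left (a : M → ℝ) (X Y : ∀ x : M, TangentSpace I x) :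
    metricFn I (a • X) Y = a • metricFn I X Y := by
  funext x; exact real_inner_smul_left _ _ _

theorem metricFn_add_right (X Y Y' : ∀ x : M, TangentSpace I x) :
    metricFn I X (Y + Y') = metricFn I X Y + metricFn I X Y' := by
  funext x; exact inner_add_right _ _ _

theorem metricFn_smul_right (a : M → ℝ) (X Y : ∀ x : M, TangentSpace I x) :
    metricFn I X (a • Y) = a • metricFn I X Y := by
  funext x; exact real_inner_smul_right _ _ _

theorem tensorial_koszul_left (Y W : ∀ x : M, TangentSpace I x) (x : M)
    (hY : MDiffAt (T% Y) x) (hW : MDiffAt (T% W) x) :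
    TensorialAt I E (fun U => koszul I Y U W x) x where
  smul {a U} ha hU := by
    have h1 := mdifferentiableAt_metricFn hU hW
    have h2 := mdifferentiableAt_metricFn hU hY
    simp only [koszul, metricFn_smul_left, mvfderiv_smul ha h1, mvfderiv_smul ha h2,
      mlieBracket_smul_left ha hU]
    simp [inner_add_left, inner_smul_left, inner_smul_right, metricFn]
    ring
  add {U U'} hU hU' := by
    have h1 := mdifferentiableAt_metricFn hU hW
    have h2 := mdifferentiableAt_metricFn hU hY
    have h1' := mdifferentiableAt_metricFn hU' hW
    have h2' := mdifferentiableAt_metricFn hU' hY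
    simp only [koszul, metricFn_add_left, mvfderiv_add h1 h1', mvfderiv_add h2 h2',
      mlieBracket_add_left hU hU']
    simp [inner_add_left, inner_add_right]
    ring

theorem tensorial_koszul_right (Y U : ∀ x : M, TangentSpace I x) (x : M)
    (hY : MDiffAt (T% Y) x) (hU : MDiffAt (T% U) x) :
    TensorialAt I E (fun W => koszul I Y U W x) x where
  smul {a W} ha hW := by
    have h1 := mdifferentiableAt_metricFn hY hW
    have h2 := mdifferentiableAt_metricFn hU hW
    simp only [koszul, metricFn_smul_right, mvfderiv_smul ha h1, mvfderiv_smul ha h2,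
      mlieBracket_smul_right ha hW]
    simp [inner_add_left, inner_smul_left, inner_smul_right, metricFn]
    rw [real_inner_comm (U x) (W x), real_inner_comm (Y x) (W x)]
    ring
  add {W W'} hW hW' := by
    have h1 := mdifferentiableAt_metricFn hY hW
    have h2 := mdifferentiableAt_metricFn hU hW
    have h1' := mdifferentiableAt_metricFn hY hW'
    have h2' := mdifferentiableAt_metricFn hU hW'
    simp only [koszul, metricFn_add_right, mvfderiv_add h1 h1', mvfderiv_add h2 h2',
      mlieBracket_add_right hW hW']
    simp [inner_add_left, inner_add_right]
    ring

theorem koszul_add (Y Y' U W : ∀ x : M, TangentSpace I x) (x : M)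
    (hY : MDiffAt (T% Y) x) (hY' : MDiffAt (T% Y') x)
    (hU : MDiffAt (T% U) x) (hW : MDiffAt (T% W) x) :
    koszul I (Y + Y') U W x = koszul I Y U W x + koszul I Y' U W x := by
  have h1 := mdifferentiableAt_metricFn hY hW
  have h2 := mdifferentiableAt_metricFn hU hY
  have h1' := mdifferentiableAt_metricFn hY' hW
  have h2' := mdifferentiableAt_metricFn hU hY'
  simp only [koszul, metricFn_add_left, metricFn_add_right, mvfderiv_add h1 h1',
    mvfderiv_add h2 h2', mlieBracket_add_right hY hY', mlieBracket_add_left hY hY']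
  simp [inner_add_left, inner_add_right]
  ring

theorem koszul_smul (a : M → ℝ) (Y U W : ∀ x : M, TangentSpace I x) (x : M)
    (ha : MDiffAt a x) (hY : MDiffAt (T% Y) x)
    (hU : MDiffAt (T% U) x) (hW : MDiffAt (T% W) x) :
    koszul I (a • Y) U W x
      = a x * koszul I Y U W x + mvfderiv I a x (U x) * inner ℝ (Y x) (W x) := by
  have h1 := mdifferentiableAt_metricFn hY hW
  have h2 := mdifferentiableAt_metricFn hU hY
  simp only [koszul, metricFn_smul_left, metricFn_smul_right, mvfderiv_smul ha h1,
    mvfderiv_smul ha h2, mlieBracket_smul_right ha hY, mlieBracket_smul_left ha hY]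
  simp [inner_add_left, inner_smul_left, inner_smul_right, metricFn]
  rw [real_inner_comm (U x) (Y x)]
  ring

/-- The bilinear form `(u, w) ↦ g(∇_u Y, w)` on `T_x M`, for a vector field `Y` that is
differentiable at `x`. -/
def koszulForm (Y : ∀ x : M, TangentSpace I x) (x : M) (hY : MDiffAt (T% Y) x) :
    TangentSpace I x →L[ℝ] TangentSpace I x →L[ℝ] ℝ :=
  TensorialAt.mkHom₂ (I := I) (F := E) (F' := E) (fun U W => koszul I Y U W x) x
    (fun W hW => tensorial_koszul_left I Y W x hY hW)
    (fun U hU => tensorial_koszul_right I Y U x hY hU)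

theorem koszulForm_apply (Y U W : ∀ x : M, TangentSpace I x) (x : M) (hY : MDiffAt (T% Y) x)
    (hU : MDiffAt (T% U) x) (hW : MDiffAt (T% W) x) :
    koszulForm I Y x hY (U x) (W x) = koszul I Y U W x :=
  TensorialAt.mkHom₂_apply (I := I) (F := E) (F' := E) _ _ hU hW

open Classical in
/-- `leviCivitaFun Y x u = (∇_u Y)(x)`, the Riesz representative of the Koszul form (and `0` at
points where `Y` is not differentiable). -/
def leviCivitaFun (Y : ∀ x : M, TangentSpace I x) (x : M) :
    TangentSpace I x →L[ℝ] TangentSpace I x :=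
  if hY : MDiffAt (T% Y) x then
    LinearMap.toContinuousLinearMap
      { toFun := fun u => (InnerProductSpace.toDual ℝ (TangentSpace I x)).symm
          (koszulForm I Y x hY u)
        map_add' := fun u v => by simp
        map_smul' := fun c u => by simp }
  else 0

theorem inner_leviCivitaFun (Y U W : ∀ x : M, TangentSpace I x) (x : M)
    (hY : MDiffAt (T% Y) x) (hU : MDiffAt (T% U) x) (hW : MDiffAt (T% W) x) :
    inner ℝ (leviCivitaFun I Y x (U x)) (W x) = koszul I Y U W x := by
  rw [← koszulForm_apply I Y U W x hY hU hW]
  simp [leviCivitaFun, hY]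

theorem eq_of_inner_eq {x : M} {A B : TangentSpace I x →L[ℝ] TangentSpace I x}
    (h : ∀ U W : ∀ y : M, TangentSpace I y, MDiffAt (T% U) x → MDiffAt (T% W) x →
      (inner ℝ (A (U x)) (W x) : ℝ) = inner ℝ (B (U x)) (W x)) : A = B := by
  ext u
  refine ext_inner_right ℝ fun w => ?_
  simpa using h (FiberBundle.extend E u) (FiberBundle.extend E w)
    (FiberBundle.mdifferentiableAt_extend I E u) (FiberBundle.mdifferentiableAt_extend I E w)

/-- The Levi-Civita connection of the Riemannian metric `g`. -/
def leviCivita : CovariantDerivative I E (fun x : M => TangentSpace I x) where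
  toFun := leviCivitaFun I
  isCovariantDerivativeOnUniv :=
    { add := by
        intro Y Y' x hY hY' _
        refine eq_of_inner_eq I fun U W hU hW => ?_
        have hYY : MDiffAt (T% (Y + Y')) x := mdifferentiableAt_add_section hY hY'
        rw [inner_leviCivitaFun I _ U W x hYY hU hW, koszul_add I Y Y' U W x hY hY' hU hW]
        simp [inner_add_left, inner_leviCivitaFun I _ U W x hY hU hW,
          inner_leviCivitaFun I _ U W x hY' hU hW]
      leibniz := by
        intro Y a x hY ha _
        refine eq_of_inner_eq I fun U W hU hW => ?_
        have haY : MDiffAt (T% (a • Y)) x := ha.smul_section hY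
        rw [inner_leviCivitaFun I _ U W x haY hU hW, koszul_smul I a Y U W x ha hY hU hW]
        simp [inner_add_left, inner_smul_left, inner_leviCivitaFun I _ U W x hY hU hW] }

theorem inner_leviCivita (Y U W : ∀ x : M, TangentSpace I x) (x : M)
    (hY : MDiffAt (T% Y) x) (hU : MDiffAt (T% U) x) (hW : MDiffAt (T% W) x) :
    inner ℝ (leviCivita I Y x (U x)) (W x) = koszul I Y U W x :=
  inner_leviCivitaFun I Y U W x hY hU hW

/-- The Levi-Civita connection is metric: `X g(Y,Z) = g(∇_X Y, Z) + g(Y, ∇_X Z)`. -/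
theorem leviCivita_metric (X Y Z : ∀ x : M, TangentSpace I x) (x : M)
    (hX : MDiffAt (T% X) x) (hY : MDiffAt (T% Y) x) (hZ : MDiffAt (T% Z) x) :
    mvfderiv I (metricFn I Y Z) x (X x)
      = inner ℝ (leviCivita I Y x (X x)) (Z x) + inner ℝ (Y x) (leviCivita I Z x (X x)) := by
  have h1 := inner_leviCivita I Y X Z x hY hX hZ
  have h2 := inner_leviCivita I Z X Y x hZ hX hY
  rw [real_inner_comm] at h2
  rw [h1, h2]
  simp only [koszul, metricFn_comm I X Y, metricFn_comm I Z Y, metricFn_comm I X Z,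
    mlieBracket_swap_apply (V := Z) (W := Y)]
  simp
  ring

/-- The Levi-Civita connection is torsion-free. -/
theorem leviCivita_torsion :
    (leviCivita I : CovariantDerivative I E (fun x : M => TangentSpace I x)).torsion = 0 := by
  rw [CovariantDerivative.torsion_eq_zero_iff]
  intro X Y x hX hY
  refine ext_inner_right ℝ fun w => ?_
  have hW := FiberBundle.mdifferentiableAt_extend I E w
  have h1 := inner_leviCivita I Y X (FiberBundle.extend E w) x hY hX hW
  have h2 := inner_leviCivita I X Y (FiberBundle.extend E w) x hX hY hW
  rw [FiberBundle.extend_apply_self] at h1 h2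
  rw [inner_sub_left, h1, h2]
  simp only [koszul, metricFn_comm I Y X, mlieBracket_swap_apply (V := Y) (W := X)]
  simp
  ring

end LeviCivita

section Tensors

variable {E : Type*} [NormedAddCommGroup E] [NormedSpace ℝ E] [FiniteDimensional ℝ E]
  {H : Type*} [TopologicalSpace H] (I : ModelWithCorners ℝ E H)
  {M : Type*} [TopologicalSpace M] [ChartedSpace H M] [IsManifold I ∞ M]

/-- `X` is a smooth vector field on `M`. -/
def IsSmoothVectorField (X : ∀ x : M, TangentSpace I x) : Prop :=
  ContMDiff I I.tangent ∞ (T% X)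

/-- `T` is a smooth `(1,1)`-tensor field on `M`. -/
def IsSmoothEndomorphismField (T : ∀ x : M, TangentSpace I x →L[ℝ] TangentSpace I x) : Prop :=
  ContMDiff I (I.prod 𝓘(ℝ, E →L[ℝ] E)) ∞
    (fun x => TotalSpace.mk' (E →L[ℝ] E)
      (E := fun x : M => TangentSpace I x →L[ℝ] TangentSpace I x) x (T x))

/-- `θ` is a smooth 1-form on `M`. -/
def IsSmoothOneForm (θ : ∀ x : M, TangentSpace I x →L[ℝ] ℝ) : Prop :=
  ContMDiff I (I.prod 𝓘(ℝ, E →L[ℝ] ℝ)) ∞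
    (fun x => TotalSpace.mk' (E →L[ℝ] ℝ)
      (E := fun x : M => TangentSpace I x →L[ℝ] Bundle.Trivial M ℝ x) x (θ x))

/-- The Lie derivative `£_V X = [V, X]` of a vector field. -/
def lieDerivVectorField (V X : ∀ x : M, TangentSpace I x) : ∀ x : M, TangentSpace I x :=
  mlieBracket I V X

/-- The Lie derivative of a 1-form: `(£_V θ)(X) = V(θ(X)) - θ([V, X])`. -/
def lieDerivOneForm (V : ∀ x : M, TangentSpace I x) (θ : ∀ x : M, TangentSpace I x →L[ℝ] ℝ)
    (X : ∀ x : M, TangentSpace I x) (x : M) : ℝ :=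
  mvfderiv I (fun y => θ y (X y)) x (V x) - θ x (lieDerivVectorField I V X x)

variable [RiemannianBundle (fun x : M => TangentSpace I x)]

/-- The Lie derivative of the metric:
`(£_V g)(X, Y) = V(g(X, Y)) - g([V, X], Y) - g(X, [V, Y])`. -/
def lieDerivMetric (V X Y : ∀ x : M, TangentSpace I x) (x : M) : ℝ :=
  mvfderiv I (metricFn I X Y) x (V x) - inner ℝ (lieDerivVectorField I V X x) (Y x)
    - inner ℝ (X x) (lieDerivVectorField I V Y x)

variable [IsContMDiffRiemannianBundle I ∞ E (fun x : M => TangentSpace I x)]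

/-- The vector field `∇_X Y`, for the Levi-Civita connection. -/
def nabla (X Y : ∀ x : M, TangentSpace I x) : ∀ x : M, TangentSpace I x :=
  fun x => leviCivita I Y x (X x)

/-- The curvature `R_{X,Y} Z = ∇_X ∇_Y Z - ∇_Y ∇_X Z - ∇_{[X,Y]} Z`. -/
def curvature (X Y Z : ∀ x : M, TangentSpace I x) : ∀ x : M, TangentSpace I x :=
  nabla I X (nabla I Y Z) - nabla I Y (nabla I X Z) - nabla I (mlieBracket I X Y) Z

/-- The curvature tensor `R_{u,v} w` at the point `x`. It is computed by extending the three
tangent vectors to vector fields that are smooth near `x`; as the curvature is a tensor, the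
choice of the extensions is irrelevant. -/
def curvatureAt (x : M) (u v w : TangentSpace I x) : TangentSpace I x :=
  curvature I (FiberBundle.extend E u) (FiberBundle.extend E v) (FiberBundle.extend E w) x

/-- The `*`-Ricci tensor `Ric*(u, v) = ½ trace {z ↦ R_{u, f v} (f z)}` of a `(1,1)`-tensor field
`f`, the trace being computed in an orthonormal basis of `T_x M`. -/
def starRicci (f : ∀ x : M, TangentSpace I x →L[ℝ] TangentSpace I x) (x : M)
    (u v : TangentSpace I x) : ℝ :=
  (1 / 2) * ∑ i, inner ℝ
    (curvatureAt I x u (f x v) (f x (stdOrthonormalBasis ℝ (TangentSpace I x) i)))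
    (stdOrthonormalBasis ℝ (TangentSpace I x) i)

variable (M)

/-- A weak almost contact metric structure `(f, Q, ξ, η)` on the Riemannian manifold `(M, g)` of
dimension `2n + 1`, with `f`-invariant distribution `ker η`. -/
structure WeakAlmostContactMetricStructure (n : ℕ) where
  f : ∀ x : M, TangentSpace I x →L[ℝ] TangentSpace I x
  Q : ∀ x : M, TangentSpace I x →L[ℝ] TangentSpace I x
  ξ : ∀ x : M, TangentSpace I x
  η : ∀ x : M, TangentSpace I x →L[ℝ] ℝ
  smooth_f : IsSmoothEndomorphismField I f
  smooth_Q : IsSmoothEndomorphismField I Q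
  smooth_ξ : IsSmoothVectorField I ξ
  smooth_η : IsSmoothOneForm I η
  finrank_eq : Module.finrank ℝ E = 2 * n + 1
  rank_f : ∀ x, Module.finrank ℝ (LinearMap.range (f x).toLinearMap) = 2 * n
  bijective_Q : ∀ x, Function.Bijective (Q x)
  f_sq : ∀ x u, f x (f x u) = -Q x u + η x u • ξ x
  η_ξ : ∀ x, η x (ξ x) = 1
  Q_ξ : ∀ x, Q x (ξ x) = ξ x
  inner_f_f : ∀ x u v, (inner ℝ (f x u) (f x v) : ℝ) = inner ℝ u (Q x v) - η x u * η x v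
  ker_η_invariant : ∀ x u, η x u = 0 → η x (f x u) = 0

namespace WeakAlmostContactMetricStructure

variable {I M} {n : ℕ} (S : WeakAlmostContactMetricStructure I M n)

/-- The vector field `(∇_X f) Y = ∇_X (f Y) - f (∇_X Y)`. -/
def nablaF (X Y : ∀ x : M, TangentSpace I x) (x : M) : TangentSpace I x :=
  nabla I X (fun y => S.f y (Y y)) x - S.f x (nabla I X Y x)

/-- The structure is weak `β`-Kenmotsu, for a non-zero constant `β`:
`(∇_X f) Y = β (g(f X, Y) ξ - η(Y) f X)` for all smooth vector fields `X`, `Y`.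
(The condition `dβ ∧ η = 0`, which is required of a function `β` if `n = 1`, is void for a
constant.) -/
def IsWeakKenmotsu (β : ℝ) : Prop :=
  β ≠ 0 ∧ ∀ X Y : ∀ x : M, TangentSpace I x,
    IsSmoothVectorField I X → IsSmoothVectorField I Y → ∀ x : M,
      S.nablaF X Y x
        = β • ((inner ℝ (S.f x (X x)) (Y x) : ℝ) • S.ξ x - S.η x (Y x) • S.f x (X x))

/-- `(g, V)` is a `*`-`η`-Ricci soliton with constants `lam`, `mu`:
`½ £_V g + Ric* = lam g + mu η ⊗ η`. -/
def IsStarEtaRicciSoliton (V : ∀ x : M, TangentSpace I x) (lam mu : ℝ) : Prop :=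
  IsSmoothVectorField I V ∧ ∀ X Y : ∀ x : M, TangentSpace I x,
    IsSmoothVectorField I X → IsSmoothVectorField I Y → ∀ x : M,
      (1 / 2) * lieDerivMetric I V X Y x + starRicci I S.f x (X x) (Y x)
        = lam * inner ℝ (X x) (Y x) + mu * (S.η x (X x) * S.η x (Y x))

/-- A `*`-`η`-Ricci soliton is shrinking if `lam` is positive. -/
def IsShrinking (V : ∀ x : M, TangentSpace I x) (lam mu : ℝ) : Prop :=
  S.IsStarEtaRicciSoliton V lam mu ∧ 0 < lam

/-- A `*`-`η`-Ricci soliton is steady if `lam` is zero. -/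
def IsSteady (V : ∀ x : M, TangentSpace I x) (lam mu : ℝ) : Prop :=
  S.IsStarEtaRicciSoliton V lam mu ∧ lam = 0

/-- A `*`-`η`-Ricci soliton is expanding if `lam` is negative. -/
def IsExpanding (V : ∀ x : M, TangentSpace I x) (lam mu : ℝ) : Prop :=
  S.IsStarEtaRicciSoliton V lam mu ∧ lam < 0

end WeakAlmostContactMetricStructure

end Tensors

end WeakKenmotsu

end

noncomputable section

namespace WeakKenmotsu

open Filter Topology

theorem contMDiffAt_det {E : Type*} [NormedAddCommGroup E] [NormedSpace ℝ E]
    {H : Type*} [TopologicalSpace H] {I : ModelWithCorners ℝ E H}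
    {M : Type*} [TopologicalSpace M] [ChartedSpace H M] {ι : Type*} [Fintype ι] [DecidableEq ι] {x : M}
    {A : M → Matrix ι ι ℝ} (hA : ∀ i j, CMDiffAt ∞ (fun y => A y i j) x) :
    CMDiffAt ∞ (fun y => (A y).det) x := by
  simp only [Matrix.det_apply]
  refine ContMDiffAt.sum fun σ _ => ?_
  have h : CMDiffAt ∞ (fun y => ∏ i, A y (σ i) i) x := ContMDiffAt.prod fun i _ => hA _ _
  simp only [Units.smul_def, zsmul_eq_mul]
  exact contMDiffAt_const.mul h

section Smooth

variable {E : Type*} [NormedAddCommGroup E] [NormedSpace ℝ E] [FiniteDimensional ℝ E]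
  {H : Type*} [TopologicalSpace H] {I : ModelWithCorners ℝ E H}
  {M : Type*} [TopologicalSpace M] [ChartedSpace H M] [IsManifold I ∞ M]

omit [FiniteDimensional ℝ E] in
/-- The derivative of a smooth function along a smooth vector field is smooth. -/
theorem contMDiff_mvfderiv_apply {φ : M → ℝ} {X : ∀ x : M, TangentSpace I x}
    (hφ : CMDiff ∞ φ) (hX : CMDiff ∞ (T% X)) :
    CMDiff ∞ (fun x => mvfderiv I φ x (X x)) := by
  have h1 : ContMDiff I.tangent 𝓘(ℝ).tangent ∞ (tangentMap I 𝓘(ℝ) φ) :=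
    hφ.contMDiff_tangentMap (by simp)
  have h2 := h1.comp hX
  intro x
  have h3 := (contMDiffAt_totalSpace.1 (h2 x)).2
  refine h3.congr_of_eventuallyEq (Eventually.of_forall fun y => ?_)
  simp [tangentMap, mvfderiv]
  rfl

variable (I) in
/-- A neighbourhood of a point carries a smooth cut-off function. -/
theorem exists_smooth_cutoff [T2Space M] {x : M} {u : Set M} (hu : u ∈ 𝓝 x) :
    ∃ χ : M → ℝ, CMDiff ∞ χ ∧ χ =ᶠ[𝓝 x] 1 ∧ tsupport χ ⊆ u := by
  obtain ⟨χ, -, h⟩ := (SmoothBumpFunction.nhds_basis_tsupport (I := I) x).mem_iff.1 hu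
  exact ⟨χ, χ.contMDiff, χ.eventuallyEq_one, h⟩

/-- A vector field that is smooth on an open set agrees near each of its points with a globally
smooth vector field. -/
theorem exists_smooth_extension [T2Space M] {X : ∀ x : M, TangentSpace I x} {x : M} {u : Set M}
    (hu : IsOpen u) (hx : x ∈ u) (hX : CMDiff[u] ∞ (T% X)) :
    ∃ Y : ∀ x : M, TangentSpace I x, CMDiff ∞ (T% Y) ∧ ∀ᶠ y in 𝓝 x, Y y = X y := by
  obtain ⟨χ, hχ, h1, h2⟩ := exists_smooth_cutoff I (hu.mem_nhds hx)
  refine ⟨χ • X, ContMDiffOn.smul_section_of_tsupport hχ.contMDiffOn hu h2 hX, ?_⟩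
  filter_upwards [h1] with y hy
  simp [hy]

theorem exists_smooth_eventuallyEq_extend [T2Space M] {x : M} (v : TangentSpace I x) :
    ∃ Y : ∀ x : M, TangentSpace I x, CMDiff ∞ (T% Y) ∧
      ∀ᶠ y in 𝓝 x, Y y = FiberBundle.extend E v y := by
  obtain ⟨s, hs, h⟩ := FiberBundle.exists_contMDiffOn_extend I E (k := ∞) v
  obtain ⟨u, hus, hu, hx⟩ := mem_nhds_iff.1 hs
  exact exists_smooth_extension hu hx (h.mono hus)

theorem contMDiff_mlieBracket {X Y : ∀ x : M, TangentSpace I x}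
    (hX : CMDiff ∞ (T% X)) (hY : CMDiff ∞ (T% Y)) : CMDiff ∞ (T% (mlieBracket I X Y)) :=
  haveI : IsManifold I (minSmoothness ℝ 2) M := by
    rw [minSmoothness_of_isRCLikeNormedField]; infer_instance
  haveI : IsManifold I (((⊤ : ℕ∞) : ℕ∞ω) + 1) M := by
    rw [show ((⊤ : ℕ∞) : ℕ∞ω) + 1 = ∞ from rfl]; infer_instance
  ContDiff.mlieBracket_vectorField (n := ⊤) (m := ⊤) hX hY (by simp)

/-- Around every point there is a finite family of smooth vector fields that is a local frame. -/
theorem exists_localFrame (x : M) :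
    ∃ (s : Fin (Module.finrank ℝ E) → ∀ x : M, TangentSpace I x) (u : Set M), IsOpen u ∧ x ∈ u ∧
      IsLocalFrameOn I E ∞ s u := by
  let e := trivializationAt E (TangentSpace I : M → Type _) x
  exact ⟨_, e.baseSet, e.open_baseSet, FiberBundle.mem_baseSet_trivializationAt' x,
    e.isLocalFrameOn_localFrame_baseSet I ∞ (Module.finBasis ℝ E)⟩

end Smooth

section Metric

variable {E : Type*} [NormedAddCommGroup E] [NormedSpace ℝ E] [FiniteDimensional ℝ E]
  {H : Type*} [TopologicalSpace H] {I : ModelWithCorners ℝ E H}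
  {M : Type*} [TopologicalSpace M] [ChartedSpace H M] [IsManifold I ∞ M]
  [RiemannianBundle (fun x : M => TangentSpace I x)]
  [IsContMDiffRiemannianBundle I ∞ E (fun x : M => TangentSpace I x)]

/-- A vector field whose inner products with smooth vector fields are smooth is smooth. -/
theorem contMDiff_of_inner [T2Space M] {W : ∀ x : M, TangentSpace I x}
    (hW : ∀ Z : ∀ x : M, TangentSpace I x, CMDiff ∞ (T% Z) → CMDiff ∞ (metricFn I W Z)) :
    CMDiff ∞ (T% W) := by
  intro x
  obtain ⟨s, u, hu, hx, hs⟩ := exists_localFrame (I := I) x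
  have key : ∀ Z : ∀ x : M, TangentSpace I x, CMDiff[u] ∞ (T% Z) →
      CMDiffAt ∞ (metricFn I W Z) x := by
    intro Z hZ
    obtain ⟨Y, hY, hYZ⟩ := exists_smooth_extension hu hx hZ
    refine (hW Y hY x).congr_of_eventuallyEq ?_
    filter_upwards [hYZ] with y hy
    simp [metricFn, hy]
  let G : M → Matrix (Fin (Module.finrank ℝ E)) (Fin (Module.finrank ℝ E)) ℝ :=
    fun y => Matrix.of fun i j => inner ℝ (s j y) (s i y)
  let b : M → Fin (Module.finrank ℝ E) → ℝ := fun y i => inner ℝ (W y) (s i y)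
  have hG : ∀ i j, CMDiffAt ∞ (fun y => G y i j) x := fun i j =>
    ContMDiffAt.inner_bundle (E := fun x : M => TangentSpace I x) (hs.contMDiffAt hu hx j) (hs.contMDiffAt hu hx i)
  have hb : ∀ i, CMDiffAt ∞ (fun y => b y i) x := fun i => key _ (hs.contMDiffOn i)
  have hdet : ∀ y ∈ u, (G y).det ≠ 0 := by
    intro y hy h0
    obtain ⟨v, hv, hGv⟩ := Matrix.exists_mulVec_eq_zero_iff.2 h0
    have h1 : ∑ j, v j • s j y = 0 := by
      rw [← inner_self_eq_zero (𝕜 := ℝ), inner_sum]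
      refine Finset.sum_eq_zero fun i _ => ?_
      have := congrFun hGv i
      simp only [Matrix.mulVec, dotProduct, G, Matrix.of_apply, Pi.zero_apply] at this
      rw [real_inner_smul_right, sum_inner]
      simp only [real_inner_smul_left]
      rw [← Finset.sum_congr rfl fun j _ => mul_comm (inner ℝ (s j y) (s i y)) (v j), this,
        mul_zero]
    exact hv (funext (Fintype.linearIndependent_iff.1 (hs.linearIndependent hy) v h1))
  have hcramer : ∀ y ∈ u, ∀ i, hs.coeff i y (W y) = (G y).det⁻¹ * ((G y).cramer (b y)) i := by
    intro y hy i
    have h1 : (G y).mulVec (fun j => hs.coeff j y (W y)) = b y := by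
      funext k
      have h2 := hs.coeff_sum_eq W hy
      simp only [Matrix.mulVec, dotProduct, G, Matrix.of_apply, b]
      conv_rhs => rw [h2, sum_inner]
      simp only [real_inner_smul_left]
      exact Finset.sum_congr rfl fun j _ => mul_comm _ _
    rw [← h1, Matrix.cramer_eq_adjugate_mulVec, Matrix.mulVec_mulVec, Matrix.adjugate_mul,
      Matrix.smul_mulVec, Matrix.one_mulVec]
    simp [hdet y hy]
  refine hs.contMDiffAt_of_coeff (fun i => ?_) (hu.mem_nhds hx)
  have h3 : CMDiffAt ∞ (fun y => (G y).det⁻¹ * ((G y).cramer (b y)) i) x := by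
    refine ContMDiffAt.mul ((contMDiffAt_det hG).inv₀ (hdet x hx)) ?_
    simp only [Matrix.cramer_apply]
    refine contMDiffAt_det fun k l => ?_
    by_cases hl : l = i
    · subst hl; simpa using hb k
    · simpa [Matrix.updateCol_apply, hl] using hG k l
  refine h3.congr_of_eventuallyEq ?_
  filter_upwards [hu.mem_nhds hx] with y hy
  exact hcramer y hy i

/-- The Levi-Civita derivative of a smooth vector field along a smooth vector field is smooth. -/
theorem contMDiff_nabla [T2Space M] {X Y : ∀ x : M, TangentSpace I x}
    (hX : CMDiff ∞ (T% X)) (hY : CMDiff ∞ (T% Y)) : CMDiff ∞ (T% (nabla I X Y)) := by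
  refine contMDiff_of_inner fun Z hZ => ?_
  have hm : ∀ {A B : ∀ x : M, TangentSpace I x}, CMDiff ∞ (T% A) → CMDiff ∞ (T% B) →
      CMDiff ∞ (metricFn I A B) := fun hA hB => ContMDiff.inner_bundle (E := fun x : M => TangentSpace I x) hA hB
  have hd : ∀ {A : ∀ x : M, TangentSpace I x}, CMDiff ∞ (T% A) → MDiff (T% A) :=
    fun hA => hA.mdifferentiable (by simp)
  have h : metricFn I (nabla I X Y) Z = koszul I Y X Z := by
    funext x
    exact inner_leviCivita I Y X Z x (hd hY x) (hd hX x) (hd hZ x)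
  rw [h]
  unfold koszul
  refine contMDiff_const.mul ((((((contMDiff_mvfderiv_apply (hm hY hZ) hX).add
    (contMDiff_mvfderiv_apply (hm hX hZ) hY)).sub (contMDiff_mvfderiv_apply (hm hX hY) hZ)).add
    (hm (contMDiff_mlieBracket hX hY) hZ)).sub (hm (contMDiff_mlieBracket hX hZ) hY)).sub
    (hm (contMDiff_mlieBracket hY hZ) hX))

end Metric

/-- The algebra of a Riemannian manifold: a module `L` of vector fields that acts by derivations on
a ring `A` of functions, with a metric and its Levi-Civita connection. -/
structure RiemannianAlgebra (A L : Type*) [CommRing A] [Algebra ℝ A] [LieRing L] [Module A L] where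
  der : L →ₗ[A] Derivation ℝ A A
  der_lie : ∀ (X Y : L) (φ : A), der ⁅X, Y⁆ φ = der X (der Y φ) - der Y (der X φ)
  lie_smul : ∀ (X Y : L) (φ : A), ⁅X, φ • Y⁆ = der X φ • Y + φ • ⁅X, Y⁆
  g : L →ₗ[A] L →ₗ[A] A
  g_comm : ∀ X Y : L, g X Y = g Y X
  g_ext : ∀ X Y : L, (∀ Z, g X Z = g Y Z) → X = Y
  nab : L →ₗ[A] L →+ L
  nab_smul : ∀ (X Y : L) (φ : A), nab X (φ • Y) = der X φ • Y + φ • nab X Y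
  der_g : ∀ X Y Z : L, der X (g Y Z) = g (nab X Y) Z + g Y (nab X Z)
  torsion : ∀ X Y : L, nab X Y - nab Y X = ⁅X, Y⁆

namespace RiemannianAlgebra

theorem eq_of_two_mul_eq {A : Type*} [CommRing A] [Algebra ℝ A] {a b : A} (h : 2 * a = 2 * b) : a = b := by
  have h2 : algebraMap ℝ A (1 / 2) * 2 = 1 := by
    rw [← map_ofNat (algebraMap ℝ A) 2, ← map_mul]; norm_num
  calc a = algebraMap ℝ A (1 / 2) * 2 * a := by rw [h2, one_mul]
    _ = algebraMap ℝ A (1 / 2) * 2 * b := by rw [mul_assoc, h, mul_assoc]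
    _ = b := by rw [h2, one_mul]

variable {A L : Type*} [CommRing A] [Algebra ℝ A] [LieRing L] [Module A L]
  (K : RiemannianAlgebra A L)

/-- The curvature of the connection. -/
def curv (X Y Z : L) : L := K.nab X (K.nab Y Z) - K.nab Y (K.nab X Z) - K.nab ⁅X, Y⁆ Z

theorem koszul_formula (X Y Z : L) :
    2 * K.g (K.nab X Y) Z = K.der X (K.g Y Z) + K.der Y (K.g X Z) - K.der Z (K.g X Y)
      + K.g ⁅X, Y⁆ Z - K.g ⁅X, Z⁆ Y - K.g ⁅Y, Z⁆ X := by
  simp only [K.der_g, ← K.torsion, map_sub, LinearMap.sub_apply]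
  rw [K.g_comm Y (K.nab X Z), K.g_comm X (K.nab Y Z), K.g_comm X (K.nab Z Y)]
  ring

theorem smul_lie (X Y : L) (φ : A) : ⁅φ • X, Y⁆ = φ • ⁅X, Y⁆ - K.der Y φ • X := by
  rw [← lie_skew, K.lie_smul, ← lie_skew X Y]
  module

theorem curv_add_left (X X' Y Z : L) : K.curv (X + X') Y Z = K.curv X Y Z + K.curv X' Y Z := by
  simp only [curv, map_add, add_lie, AddMonoidHom.add_apply]; abel

theorem curv_add_mid (X Y Y' Z : L) : K.curv X (Y + Y') Z = K.curv X Y Z + K.curv X Y' Z := by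
  simp only [curv, map_add, lie_add, AddMonoidHom.add_apply]; abel

theorem curv_add_right (X Y Z Z' : L) : K.curv X Y (Z + Z') = K.curv X Y Z + K.curv X Y Z' := by
  simp only [curv, map_add]; abel

theorem curv_smul_left (φ : A) (X Y Z : L) : K.curv (φ • X) Y Z = φ • K.curv X Y Z := by
  simp only [curv, map_smul, map_sub, K.smul_lie, AddMonoidHom.smul_apply, AddMonoidHom.sub_apply,
    K.nab_smul]
  module

theorem curv_smul_mid (φ : A) (X Y Z : L) : K.curv X (φ • Y) Z = φ • K.curv X Y Z := by
  simp only [curv, map_smul, map_add, K.lie_smul, AddMonoidHom.smul_apply,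
    AddMonoidHom.add_apply, K.nab_smul]
  module

theorem curv_smul_right (φ : A) (X Y Z : L) : K.curv X Y (φ • Z) = φ • K.curv X Y Z := by
  simp only [curv, map_add, K.nab_smul, K.der_lie]
  module

/-- The curvature endomorphism. -/
def curvEnd (X Y : L) : L →ₗ[A] L where
  toFun := K.curv X Y
  map_add' := K.curv_add_right X Y
  map_smul' φ := K.curv_smul_right φ X Y

/-- The Lie derivative of a covariant 2-tensor. -/
def lieTensor (W : L) (T : L →+ L →+ A) : L →+ L →+ A :=
  AddMonoidHom.mk' (fun X => AddMonoidHom.mk'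
      (fun Y => K.der W (T X Y) - T ⁅W, X⁆ Y - T X ⁅W, Y⁆)
      (fun Y Y' => by simp only [map_add, lie_add]; abel))
    (fun X X' => by
      ext Y
      simp only [AddMonoidHom.mk'_apply, map_add, lie_add, AddMonoidHom.add_apply]; abel)

theorem lieTensor_apply (W : L) (T : L →+ L →+ A) (X Y : L) :
    K.lieTensor W T X Y = K.der W (T X Y) - T ⁅W, X⁆ Y - T X ⁅W, Y⁆ := rfl

theorem lieTensor_lie (W W' : L) (T : L →+ L →+ A) (X Y : L) :
    K.lieTensor ⁅W, W'⁆ T X Y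
      = K.lieTensor W (K.lieTensor W' T) X Y - K.lieTensor W' (K.lieTensor W T) X Y := by
  have h : ∀ Z : L, ⁅⁅W, W'⁆, Z⁆ = ⁅W, ⁅W', Z⁆⁆ - ⁅W', ⁅W, Z⁆⁆ := fun Z : L => lie_lie W W' Z
  simp only [lieTensor_apply, K.der_lie, h, map_sub, AddMonoidHom.sub_apply]
  abel

theorem lieTensor_add (W : L) (T T' : L →+ L →+ A) :
    K.lieTensor W (T + T') = K.lieTensor W T + K.lieTensor W T' := by
  ext X Y
  simp only [lieTensor_apply, AddMonoidHom.add_apply, map_add]; abel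

theorem lieTensor_sub (W : L) (T T' : L →+ L →+ A) :
    K.lieTensor W (T - T') = K.lieTensor W T - K.lieTensor W T' := by
  ext X Y
  simp only [lieTensor_apply, AddMonoidHom.sub_apply, map_sub]; abel

theorem lieTensor_smul {W : L} {a : A} (ha : K.der W a = 0) (T : L →+ L →+ A) :
    K.lieTensor W (a • T) = a • K.lieTensor W T := by
  ext X Y
  simp only [lieTensor_apply, AddMonoidHom.smul_apply, smul_eq_mul, Derivation.leibniz, ha]; ring

/-- The metric as a biadditive map. -/
def gTensor : L →+ L →+ A :=
  AddMonoidHom.mk' (fun X => (K.g X).toAddMonoidHom) (fun X X' => by ext Y; simp)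

theorem gTensor_apply (X Y : L) : K.gTensor X Y = K.g X Y := rfl

end RiemannianAlgebra

open RiemannianAlgebra

/-- The part of a weak Kenmotsu structure that its `*`-Ricci tensor depends on. The function `b` is
the constant `β`. -/
structure KenmotsuAlgebra (A L : Type*) [CommRing A] [Algebra ℝ A] [LieRing L] [Module A L] extends
    RiemannianAlgebra A L where
  F : L →ₗ[A] L
  ξ : L
  η : L →ₗ[A] A
  b : A
  der_b : ∀ X : L, der X b = 0
  η_eq : ∀ X : L, η X = g X ξ
  η_ξ : η ξ = 1
  F_ξ : F ξ = 0
  nab_ξ : ∀ X : L, nab X ξ = b • (X - η X • ξ)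
  nab_F : ∀ X Y : L, nab X (F Y) - F (nab X Y) = b • (g (F X) Y • ξ - η Y • F X)
  η_F : ∀ X : L, η (F X) = 0

namespace KenmotsuAlgebra

variable {A L : Type*} [CommRing A] [Algebra ℝ A] [LieRing L] [Module A L]
  (K : KenmotsuAlgebra A L)

theorem der_two (X : L) : K.der X 2 = 0 := by
  have h := (K.der X).map_algebraMap 2
  rwa [map_ofNat] at h

theorem der_η (X Y : L) : K.der X (K.η Y) = K.η (K.nab X Y) + K.b * (K.g X Y - K.η X * K.η Y) := by
  rw [K.η_eq Y, K.der_g, ← K.η_eq, K.nab_ξ]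
  simp only [map_smul, map_sub, smul_eq_mul, ← K.η_eq, K.g_comm Y X]

/-- The 1-form `η` is closed. -/
theorem η_lie (X Y : L) : K.η ⁅X, Y⁆ = K.der X (K.η Y) - K.der Y (K.η X) := by
  rw [← K.torsion, map_sub, K.der_η, K.der_η, K.g_comm Y X]
  ring

theorem der_ξ_η (X : L) : K.der K.ξ (K.η X) = K.η ⁅K.ξ, X⁆ := by
  rw [K.η_lie, K.η_ξ, Derivation.map_one_eq_zero, sub_zero]

/-- The Lie derivative of the metric along `ξ` is `2β (g - η ⊗ η)`. -/
theorem der_ξ_g (X Y : L) :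
    K.der K.ξ (K.g X Y) = K.g ⁅K.ξ, X⁆ Y + K.g X ⁅K.ξ, Y⁆
      + 2 * K.b * (K.g X Y - K.η X * K.η Y) := by
  rw [K.der_g, ← K.torsion, ← K.torsion, K.nab_ξ, K.nab_ξ]
  simp only [map_smul, map_sub, smul_eq_mul, LinearMap.smul_apply, LinearMap.sub_apply,
    ← K.η_eq, K.g_comm K.ξ]
  ring

/-- The tensor field `F` is invariant under the flow of `ξ`. -/
theorem lie_ξ_F (X : L) : ⁅K.ξ, K.F X⁆ = K.F ⁅K.ξ, X⁆ := by
  have h := K.nab_F K.ξ X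
  rw [K.F_ξ] at h
  rw [← K.torsion, ← K.torsion, K.nab_ξ, K.nab_ξ]
  simp only [map_zero, LinearMap.zero_apply, zero_smul, smul_zero, sub_zero, map_sub, map_smul,
    K.η_F, K.F_ξ] at h ⊢
  rw [sub_eq_zero] at h
  rw [h]

theorem der_ξ_der (X : L) (φ : A) :
    K.der K.ξ (K.der X φ) = K.der ⁅K.ξ, X⁆ φ + K.der X (K.der K.ξ φ) := by
  rw [K.der_lie]; ring

/-- The Lie derivative of the Levi-Civita connection along `ξ`. -/
theorem lie_ξ_nab (X Y : L) :
    ⁅K.ξ, K.nab X Y⁆ = K.nab ⁅K.ξ, X⁆ Y + K.nab X ⁅K.ξ, Y⁆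
      - (2 * K.b ^ 2 * (K.g X Y - K.η X * K.η Y)) • K.ξ := by
  refine K.g_ext _ _ fun Z => eq_of_two_mul_eq ?_
  have h := congrArg (K.der K.ξ) (K.koszul_formula X Y Z)
  have h1 := K.koszul_formula ⁅K.ξ, X⁆ Y Z
  have h2 := K.koszul_formula X ⁅K.ξ, Y⁆ Z
  have h3 := K.koszul_formula X Y ⁅K.ξ, Z⁆
  have h0 := K.koszul_formula X Y Z
  have jac : ∀ U W : L, ⁅K.ξ, ⁅U, W⁆⁆ = ⁅⁅K.ξ, U⁆, W⁆ + ⁅U, ⁅K.ξ, W⁆⁆ :=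
    fun U W => leibniz_lie K.ξ U W
  have e1 := K.η_lie X Y
  have e2 := K.η_lie X Z
  have e3 := K.η_lie Y Z
  have e4 := K.der_η X Y
  have e5 := K.g_comm ⁅X, ⁅K.ξ, Z⁆⁆ Y
  simp only [map_add, map_sub, K.der_ξ_der, K.der_ξ_g, jac, LinearMap.add_apply,
    Derivation.leibniz, K.der_two, K.der_b, smul_eq_mul, mul_zero, add_zero] at h
  simp only [map_add, map_sub, map_smul, LinearMap.add_apply, LinearMap.sub_apply,
    LinearMap.smul_apply, smul_eq_mul, K.g_comm K.ξ, ← K.η_eq]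
  rw [e1, e2, e3] at h
  linear_combination h - h1 - h2 - h3 - 2 * K.b * h0 - 4 * K.b * K.η Z * e4

/-- The Lie derivative of the curvature along `ξ`. -/
theorem lie_ξ_curv (X Y Z : L) :
    ⁅K.ξ, K.curv X Y Z⁆ = K.curv ⁅K.ξ, X⁆ Y Z + K.curv X ⁅K.ξ, Y⁆ Z + K.curv X Y ⁅K.ξ, Z⁆
      - (2 * K.b ^ 3) • ((K.g Y Z - K.η Y * K.η Z) • X - (K.g X Z - K.η X * K.η Z) • Y) := by
  have jac : ⁅K.ξ, ⁅X, Y⁆⁆ = ⁅⁅K.ξ, X⁆, Y⁆ + ⁅X, ⁅K.ξ, Y⁆⁆ := leibniz_lie K.ξ X Y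
  have key : ∀ U W : L, K.der U (K.g W Z - K.η W * K.η Z) = K.g (K.nab U W) Z + K.g W (K.nab U Z)
      - (K.η (K.nab U W) + K.b * (K.g U W - K.η U * K.η W)) * K.η Z
      - K.η W * (K.η (K.nab U Z) + K.b * (K.g U Z - K.η U * K.η Z)) := by
    intro U W
    simp only [map_sub, Derivation.leibniz, K.der_g, K.der_η, smul_eq_mul]
    ring
  have hg := K.g_comm X Y
  have hl : K.g ⁅X, Y⁆ Z = K.g (K.nab X Y) Z - K.g (K.nab Y X) Z := by
    rw [← K.torsion, map_sub, LinearMap.sub_apply]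
  have hη : K.η ⁅X, Y⁆ = K.η (K.nab X Y) - K.η (K.nab Y X) := by rw [← K.torsion, map_sub]
  simp only [curv, lie_sub, K.lie_ξ_nab, map_add, map_sub, jac, AddMonoidHom.add_apply,
    K.nab_smul, K.nab_ξ]
  simp only [Derivation.leibniz, K.der_two, K.der_b, smul_eq_mul, mul_zero, add_zero,
    pow_two, key, hl, hη, hg]
  module

/-- The tensor `η ⊗ η` as a biadditive map. -/
def ηTensor : L →+ L →+ A :=
  AddMonoidHom.mk' (fun X => AddMonoidHom.mk' (fun Y => K.η X * K.η Y)
      (fun Y Y' => by simp only [map_add]; ring))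
    (fun X X' => by
      ext Y
      simp only [AddMonoidHom.mk'_apply, map_add, AddMonoidHom.add_apply]; ring)

theorem ηTensor_apply (X Y : L) : K.ηTensor X Y = K.η X * K.η Y := rfl

theorem lieTensor_ξ_gTensor : K.lieTensor K.ξ K.gTensor = (2 * K.b) • (K.gTensor - K.ηTensor) := by
  ext X Y
  simp only [lieTensor_apply, gTensor_apply, ηTensor_apply, AddMonoidHom.smul_apply,
    AddMonoidHom.sub_apply, smul_eq_mul, K.der_ξ_g]
  ring

theorem lieTensor_ξ_ηTensor : K.lieTensor K.ξ K.ηTensor = 0 := by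
  ext X Y
  simp only [lieTensor_apply, ηTensor_apply, AddMonoidHom.zero_apply, Derivation.leibniz,
    K.der_ξ_η, smul_eq_mul]
  ring

theorem lieTensor_ηTensor {W : L} (hW : ∀ X : L, K.der X (K.η W) = 0) :
    K.lieTensor W K.ηTensor = 0 := by
  ext X Y
  simp only [lieTensor_apply, ηTensor_apply, AddMonoidHom.zero_apply, Derivation.leibniz,
    K.η_lie, hW, smul_eq_mul]
  ring

theorem der_two_mul_b (X : L) : K.der X (2 * K.b) = 0 := by
  simp [Derivation.leibniz, K.der_two, K.der_b]

/-- The algebraic core: a metric whose Lie derivative along `V` is determined by a tensor `R` that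
evolves along `ξ` like the `*`-Ricci tensor of a Kenmotsu structure has `λ + μ = 0`. -/
theorem soliton_constants {V : L} {lam mu : A} {R : L → L → A}
    (hlam : ∀ X : L, K.der X lam = 0) (hmu : ∀ X : L, K.der X mu = 0)
    (hsol : ∀ X Y : L, K.lieTensor V K.gTensor X Y
      = 2 * (lam * K.g X Y + mu * (K.η X * K.η Y)) - 2 * R X Y)
    (hR : ∀ X Y : L, K.der K.ξ (R X Y) = R ⁅K.ξ, X⁆ Y + R X ⁅K.ξ, Y⁆
      - 2 * K.b ^ 3 * K.g (K.F X) (K.F Y))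
    (hRξ : ∀ X : L, R X K.ξ = 0) (X Y : L) :
    K.b ^ 2 * (lam + mu) * (K.g X Y - K.η X * K.η Y) = 0 := by
  set h := K.lieTensor V K.gTensor with hh
  set U := ⁅K.ξ, V⁆ with hU
  have gξ : ∀ X, K.g X K.ξ = K.η X := fun X => (K.η_eq X).symm
  have h1 : ∀ X Y, K.lieTensor K.ξ h X Y
      = 4 * lam * K.b * (K.g X Y - K.η X * K.η Y) + 4 * K.b ^ 3 * K.g (K.F X) (K.F Y) := by
    intro X Y
    rw [lieTensor_apply]
    simp only [hsol, map_add, map_sub, Derivation.leibniz, K.der_ξ_g, K.der_ξ_η, hR, K.der_two,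
      hlam, hmu, smul_eq_mul]
    ring
  have h2 : K.lieTensor K.ξ (K.lieTensor K.ξ h) = (2 * K.b) • K.lieTensor K.ξ h := by
    ext X Y
    have h4 : ∀ Z : L, K.der Z 4 = 0 := fun Z => by
      have h := (K.der Z).map_algebraMap 4
      rwa [map_ofNat] at h
    rw [lieTensor_apply]
    simp only [h1, map_add, map_sub, Derivation.leibniz, Derivation.leibniz_pow, K.der_ξ_g,
      K.der_ξ_η, h4, hlam, K.der_b, smul_eq_mul, K.lie_ξ_F, K.η_F, AddMonoidHom.smul_apply]
    ring
  have hηU : K.η U = lam + mu := by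
    refine eq_of_two_mul_eq ?_
    have h5 := hsol K.ξ K.ξ
    have h6 : K.η ⁅V, K.ξ⁆ = - K.η U := by rw [hU, ← lie_skew, map_neg]
    rw [hRξ, lieTensor_apply] at h5
    simp only [gTensor_apply, gξ, K.η_ξ, K.g_comm K.ξ, Derivation.map_one_eq_zero, h6] at h5
    linear_combination h5
  have hconst : ∀ X : L, K.der X (K.η U) = 0 := fun X => by rw [hηU, map_add, hlam, hmu, add_zero]
  have hgU : ∀ X, K.g U X = 2 * (lam + mu) * K.η X - K.der X (K.η V) := by
    intro X
    have h5 := hsol X K.ξ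
    have h6 : ⁅V, K.ξ⁆ = - U := by rw [hU, ← lie_skew]
    rw [hRξ, lieTensor_apply] at h5
    simp only [gTensor_apply, gξ, K.η_ξ, h6, K.η_lie, map_neg, K.g_comm X U] at h5
    linear_combination h5
  have hξU : ⁅K.ξ, U⁆ = (-(2 * K.b)) • (U - (lam + mu) • K.ξ) := by
    refine K.g_ext _ _ fun X => ?_
    have h5 := congrArg (K.der K.ξ) (hgU X)
    have h6 := hgU ⁅K.ξ, X⁆
    have h7 : K.der K.ξ (K.der X (K.η V)) = K.der ⁅K.ξ, X⁆ (K.η V) := by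
      rw [K.der_ξ_der, K.der_ξ_η, ← hU, hconst, add_zero]
    simp only [map_sub, map_add, Derivation.leibniz, K.der_ξ_g, K.der_ξ_η, h7, hηU, K.der_two,
      hlam, hmu, smul_eq_mul] at h5
    simp only [map_sub, map_smul, LinearMap.smul_apply, LinearMap.sub_apply, smul_eq_mul,
      K.g_comm K.ξ, gξ]
    linear_combination h5 - h6
  have h3 : K.lieTensor K.ξ h = (2 * K.b) • (h - K.lieTensor V K.ηTensor)
      + K.lieTensor U K.gTensor := by
    ext X Y
    have h5 := K.lieTensor_lie K.ξ V K.gTensor X Y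
    rw [K.lieTensor_ξ_gTensor, K.lieTensor_smul (K.der_two_mul_b V), K.lieTensor_sub] at h5
    rw [AddMonoidHom.add_apply, AddMonoidHom.add_apply, h5]
    abel
  have h4 : K.lieTensor K.ξ (K.lieTensor V K.ηTensor) = 0 := by
    ext X Y
    have h5 := K.lieTensor_lie K.ξ V K.ηTensor X Y
    rw [K.lieTensor_ξ_ηTensor, ← hU, K.lieTensor_ηTensor hconst] at h5
    simpa [lieTensor_apply] using h5.symm
  have h5 : K.lieTensor K.ξ (K.lieTensor U K.gTensor) = 0 := by
    have h6 := congrArg (K.lieTensor K.ξ) h3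
    rw [h2, K.lieTensor_add, K.lieTensor_smul (K.der_two_mul_b K.ξ), K.lieTensor_sub, h4] at h6
    simpa using h6
  have h6 := K.lieTensor_lie K.ξ U K.gTensor X Y
  rw [h5, K.lieTensor_ξ_gTensor, K.lieTensor_smul (K.der_two_mul_b U), K.lieTensor_sub,
    K.lieTensor_ηTensor hconst, hξU] at h6
  have h8 : K.der (U - (lam + mu) • K.ξ) (2 * K.b) = 0 := K.der_two_mul_b _
  have hb : ∀ Z : L, K.der Z (-(2 * K.b)) = 0 := fun Z => by rw [map_neg, K.der_two_mul_b, neg_zero]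
  have hc : ∀ Z : L, K.der Z (lam + mu) = 0 := fun Z => by rw [map_add, hlam, hmu, add_zero]
  simp only [lieTensor_apply, gTensor_apply, K.smul_lie, sub_lie, map_smul, map_sub, hb, hc,
    LinearMap.smul_apply, LinearMap.sub_apply, zero_smul, sub_zero, Derivation.smul_apply,
    Derivation.sub_apply, K.der_ξ_g, AddMonoidHom.smul_apply,
    AddMonoidHom.zero_apply, smul_eq_mul] at h6
  refine eq_of_two_mul_eq (eq_of_two_mul_eq ?_)
  linear_combination h6

end KenmotsuAlgebra

section Fields

set_option linter.unusedSectionVars false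

variable {E : Type*} [NormedAddCommGroup E] [NormedSpace ℝ E] [FiniteDimensional ℝ E]
  {H : Type*} [TopologicalSpace H] (I : ModelWithCorners ℝ E H)
  (M : Type*) [TopologicalSpace M] [ChartedSpace H M] [IsManifold I ∞ M]

/-- The ring of smooth functions. -/
abbrev SmoothFn : Type _ := C^∞⟮I, M; 𝓘(ℝ), ℝ⟯

/-- The module of smooth vector fields. -/
abbrev SmoothField : Type _ := Cₛ^∞⟮I; E, (TangentSpace I : M → Type _)⟯

variable {I M}

theorem SmoothFn.mdifferentiableAt (φ : SmoothFn I M) (x : M) : MDiffAt φ x :=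
  φ.contMDiff.mdifferentiable (by simp) x

theorem SmoothField.mdifferentiableAt (X : SmoothField I M) (x : M) : MDiffAt (T% fun y => X y) x :=
  X.contMDiff.mdifferentiable (by simp) x

theorem SmoothFn.add_apply (φ ψ : SmoothFn I M) (x : M) : (φ + ψ) x = φ x + ψ x := rfl

theorem SmoothFn.sub_apply (φ ψ : SmoothFn I M) (x : M) : (φ - ψ) x = φ x - ψ x := rfl

theorem SmoothFn.mul_apply (φ ψ : SmoothFn I M) (x : M) : (φ * ψ) x = φ x * ψ x := rfl

theorem SmoothFn.sum_apply {ι : Type*} (s : Finset ι) (φ : ι → SmoothFn I M) (x : M) :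
    (∑ i ∈ s, φ i) x = ∑ i ∈ s, φ i x :=
  map_sum (ContMDiffMap.evalRingHom x) φ s

instance : SMul (SmoothFn I M) (SmoothField I M) :=
  ⟨fun φ X => ⟨fun x => φ x • X x, ContMDiff.smul_section φ.contMDiff X.contMDiff⟩⟩

theorem SmoothField.smul_apply (φ : SmoothFn I M) (X : SmoothField I M) (x : M) :
    (φ • X) x = φ x • X x := rfl

theorem SmoothField.add_apply (X Y : SmoothField I M) (x : M) : (X + Y) x = X x + Y x := rfl

theorem SmoothField.sub_apply (X Y : SmoothField I M) (x : M) : (X - Y) x = X x - Y x := rfl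

theorem SmoothField.sum_apply {ι : Type*} (s : Finset ι) (X : ι → SmoothField I M) (x : M) :
    (∑ i ∈ s, X i) x = ∑ i ∈ s, X i x := by
  have h := map_sum (ContMDiffSection.coeAddHom I E ∞ (TangentSpace I : M → Type _)) X s
  have h' := congrFun h x
  rw [Finset.sum_apply] at h'
  exact h'

instance : Module (SmoothFn I M) (SmoothField I M) where
  one_smul X := by ext x; exact one_smul ℝ _
  mul_smul φ ψ X := by ext x; exact mul_smul (φ x) (ψ x) _
  smul_zero φ := by ext x; exact smul_zero (φ x)
  smul_add φ X Y := by ext x; exact smul_add (φ x) _ _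
  add_smul φ ψ X := by ext x; exact add_smul (φ x) (ψ x) _
  zero_smul X := by ext x; exact zero_smul ℝ _

instance : Bracket (SmoothField I M) (SmoothField I M) :=
  ⟨fun X Y => ⟨mlieBracket I X Y, contMDiff_mlieBracket X.contMDiff Y.contMDiff⟩⟩

instance : LieRing (SmoothField I M) where
  add_lie X Y Z := by
    ext x; exact mlieBracket_add_left (X.mdifferentiableAt x) (Y.mdifferentiableAt x)
  lie_add X Y Z := by
    ext x; exact mlieBracket_add_right (Y.mdifferentiableAt x) (Z.mdifferentiableAt x)
  lie_self X := by
    ext x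
    have h : mlieBracket I X X x = - mlieBracket I X X x := mlieBracket_swap_apply
    have h2 : (2 : ℝ) • mlieBracket I X X x = 0 := by
      rw [two_smul]; nth_rewrite 1 [h]; exact neg_add_cancel _
    exact (smul_eq_zero.1 h2).resolve_left two_ne_zero
  leibniz_lie X Y Z := by
    ext x
    have : IsManifold I (minSmoothness ℝ 3) M := by
      rw [minSmoothness_of_isRCLikeNormedField]; infer_instance
    have h : ∀ W : SmoothField I M, CMDiffAt (minSmoothness ℝ 2) (T% fun y => W y) x := fun W => by
      rw [minSmoothness_of_isRCLikeNormedField]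
      exact (W.contMDiff x).of_le (WithTop.coe_le_coe.2 (le_top : (2 : ℕ∞) ≤ ⊤))
    exact leibniz_identity_mlieBracket_apply (h X) (h Y) (h Z)

theorem mvfderiv_congr {φ ψ : M → ℝ} {x : M} (h : φ =ᶠ[𝓝 x] ψ) :
    mvfderiv I φ x = mvfderiv I ψ x := by
  ext v
  simp only [mvfderiv, h.mfderiv_eq]
  rfl

/-- The derivative of a smooth function along a smooth vector field. -/
def derivFn (X : SmoothField I M) (φ : SmoothFn I M) : SmoothFn I M :=
  ⟨fun x => mvfderiv I φ x (X x), contMDiff_mvfderiv_apply φ.contMDiff X.contMDiff⟩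

theorem derivFn_apply (X : SmoothField I M) (φ : SmoothFn I M) (x : M) :
    derivFn X φ x = mvfderiv I φ x (X x) := rfl

/-- Smooth vector fields act on smooth functions by derivations. -/
def derivation : SmoothField I M →ₗ[SmoothFn I M] Derivation ℝ (SmoothFn I M) (SmoothFn I M) where
  toFun X := Derivation.mk'
    { toFun := derivFn X
      map_add' := fun φ ψ => by
        ext x
        have h := mvfderiv_add (φ.mdifferentiableAt x) (ψ.mdifferentiableAt x)
        exact congrArg (fun l => l (X x)) h
      map_smul' := fun c φ => by
        ext x
        have h := mvfderiv_smul (mdifferentiableAt_const (c := c)) (φ.mdifferentiableAt x)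
        have h' := congrArg (fun l => l (X x)) h
        refine Eq.trans h' ?_
        simp [mvfderiv_const, derivFn_apply] }
    (fun φ ψ => by
      ext x
      have h := mvfderiv_mul (φ.mdifferentiableAt x) (ψ.mdifferentiableAt x)
      have h' := congrArg (fun l => l (X x)) h
      refine Eq.trans h' ?_
      simp [derivFn_apply])
  map_add' X Y := by
    ext φ x
    exact map_add (mvfderiv I φ x) (X x) (Y x)
  map_smul' ψ X := by
    ext φ x
    exact map_smul (mvfderiv I φ x) (ψ x) (X x)

theorem derivation_apply (X : SmoothField I M) (φ : SmoothFn I M) (x : M) :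
    derivation X φ x = mvfderiv I φ x (X x) := rfl

theorem lie_smul_field (X Y : SmoothField I M) (φ : SmoothFn I M) :
    ⁅X, φ • Y⁆ = derivation X φ • Y + φ • ⁅X, Y⁆ := by
  ext x
  exact mlieBracket_smul_right (φ.mdifferentiableAt x) (Y.mdifferentiableAt x)

variable [T2Space M]

/-- Every tangent vector extends to a smooth vector field that agrees with `FiberBundle.extend`
near the base point. -/
theorem exists_field_eventuallyEq_extend {x : M} (v : TangentSpace I x) :
    ∃ X : SmoothField I M, ∀ᶠ y in 𝓝 x, X y = FiberBundle.extend E v y := by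
  obtain ⟨X, hX, h⟩ := exists_smooth_eventuallyEq_extend v
  exact ⟨⟨X, hX⟩, h⟩

/-- A smooth vector field with a given value at a point. -/
def extendField {x : M} (v : TangentSpace I x) : SmoothField I M :=
  (exists_field_eventuallyEq_extend v).choose

theorem extendField_eventuallyEq {x : M} (v : TangentSpace I x) :
    ∀ᶠ y in 𝓝 x, extendField v y = FiberBundle.extend E v y :=
  (exists_field_eventuallyEq_extend v).choose_spec

@[simp]
theorem extendField_self {x : M} (v : TangentSpace I x) : extendField v x = v := by
  rw [(extendField_eventuallyEq v).self_of_nhds, FiberBundle.extend_apply_self]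

theorem derivation_lie (X Y : SmoothField I M) (φ : SmoothFn I M) :
    derivation ⁅X, Y⁆ φ = derivation X (derivation Y φ) - derivation Y (derivation X φ) := by
  ext x
  by_cases h0 : ∃ v : TangentSpace I x, v ≠ 0
  · obtain ⟨v, hv⟩ := h0
    let Z : SmoothField I M := extendField v
    have h : (derivation ⁅X, Y⁆ φ) • Z
        = (derivation X (derivation Y φ) - derivation Y (derivation X φ)) • Z := by
      have h1 := leibniz_lie X Y (φ • Z)
      have h2 := leibniz_lie X Y Z
      simp only [lie_smul_field, lie_add, h2] at h1
      have h3 : (derivation ⁅X, Y⁆ φ) • Z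
          - (derivation X (derivation Y φ) - derivation Y (derivation X φ)) • Z = 0 := by
        rw [← neg_eq_zero, ← sub_eq_zero.2 h1]
        module
      exact sub_eq_zero.1 h3
    have hx := congrArg (fun W : SmoothField I M => W x) h
    simp only [SmoothField.smul_apply, Z, extendField_self] at hx
    exact smul_left_injective ℝ hv hx
  · push Not at h0
    have h1 : ∀ (W : SmoothField I M) (ψ : SmoothFn I M), derivation W ψ x = 0 := fun W ψ => by
      rw [derivation_apply, h0 (W x), map_zero]
    rw [h1]
    change 0 = derivation X _ x - derivation Y _ x
    rw [h1, h1, sub_zero]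

/-- A resolution of the identity of the module of vector fields near a point. -/
theorem exists_frame (x : M) :
    ∃ (d : ℕ) (χ : SmoothFn I M) (e : Fin d → SmoothField I M)
      (c : Fin d → (SmoothField I M →ₗ[SmoothFn I M] SmoothFn I M)),
      (∀ᶠ y in 𝓝 x, χ y = 1) ∧ (∀ X, χ • X = ∑ i, c i X • e i) ∧
      ∀ i X y, X y = 0 → c i X y = 0 := by
  let t := trivializationAt E (TangentSpace I : M → Type _) x
  let b := Module.finBasis ℝ E
  obtain ⟨χ, hχ, h1, h2⟩ := exists_smooth_cutoff I
    (t.open_baseSet.mem_nhds (FiberBundle.mem_baseSet_trivializationAt' x))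
  have hsupp : ∀ y, y ∉ t.baseSet → χ y = 0 := fun y hy =>
    image_eq_zero_of_notMem_tsupport fun h => hy (h2 h)
  have hc : ∀ (i) (X : SmoothField I M),
      CMDiff ∞ (fun y => χ y * t.localFrameCoeff I b i y (X y)) := by
    intro i X
    refine contMDiff_of_tsupport fun y hy => ?_
    have hy' : y ∈ t.baseSet := h2 (tsupport_mul_subset_left hy)
    exact (hχ y).mul (contMDiffAt_localFrameCoeff b hy' (X.contMDiff y) i)
  refine ⟨Module.finrank ℝ E, ⟨fun y => χ y * χ y, hχ.mul hχ⟩,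
    fun i => ⟨χ • t.localFrame b i, ContMDiffOn.smul_section_of_tsupport hχ.contMDiffOn
      t.open_baseSet h2 (t.contMDiffOn_localFrame_baseSet ∞ b i)⟩,
    fun i => { toFun := fun X => ⟨_, hc i X⟩, map_add' := ?_, map_smul' := ?_ }, ?_, ?_, ?_⟩
  · intro X Y
    ext y
    change χ y * _ = χ y * _ + χ y * _
    rw [← mul_add, ← map_add]
    rfl
  · intro φ X
    ext y
    change χ y * _ = φ y * (χ y * _)
    rw [mul_left_comm, SmoothField.smul_apply, map_smul, smul_eq_mul]
  · filter_upwards [h1] with y hy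
    change χ y * χ y = 1
    rw [hy]; exact one_mul _
  · intro X
    ext y
    rw [SmoothField.sum_apply]
    change (χ y * χ y) • X y
      = ∑ i, (χ y * t.localFrameCoeff I b i y (X y)) • χ y • t.localFrame b i y
    by_cases hy : y ∈ t.baseSet
    · have h3 := Trivialization.eq_sum_localFrameCoeff_smul (I := I) (e := t) (b := b)
        (s := fun y => X y) hy
      conv_lhs => rw [h3, Finset.smul_sum]
      refine Finset.sum_congr rfl fun i _ => ?_
      rw [smul_smul, smul_smul]
      congr 1
      ring
    · simp [hsupp y hy]
  · intro i X y hy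
    change χ y * t.localFrameCoeff I b i y (X y) = 0
    rw [hy, map_zero, mul_zero]

/-- Module homomorphisms on vector fields are tensorial. -/
theorem linearMap_apply_eq_zero (Φ : SmoothField I M →ₗ[SmoothFn I M] SmoothField I M)
    {X : SmoothField I M} {x : M} (hX : X x = 0) : Φ X x = 0 := by
  obtain ⟨d, χ, e, c, h1, h2, h3⟩ := exists_frame (I := I) x
  have h := congrArg (fun W : SmoothField I M => W x) (congrArg Φ (h2 X))
  simp only [map_smul, map_sum, SmoothField.sum_apply, SmoothField.smul_apply,
    h1.self_of_nhds, one_smul] at h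
  rw [h]
  exact Finset.sum_eq_zero fun i _ => by rw [h3 i X x hX, zero_smul]

theorem linearForm_apply_eq_zero (θ : SmoothField I M →ₗ[SmoothFn I M] SmoothFn I M)
    {X : SmoothField I M} {x : M} (hX : X x = 0) : θ X x = 0 := by
  obtain ⟨d, χ, e, c, h1, h2, h3⟩ := exists_frame (I := I) x
  have h := congrArg (fun φ : SmoothFn I M => φ x) (congrArg θ (h2 X))
  simp only [map_smul, map_sum, SmoothFn.sum_apply, smul_eq_mul, SmoothFn.mul_apply,
    h1.self_of_nhds, one_mul] at h
  rw [h]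
  exact Finset.sum_eq_zero fun i _ => by rw [h3 i X x hX, zero_mul]

/-- The endomorphism of a tangent space that is induced by an endomorphism of the module of vector
fields. -/
def fiberEnd (Φ : SmoothField I M →ₗ[SmoothFn I M] SmoothField I M) (x : M) :
    TangentSpace I x →ₗ[ℝ] TangentSpace I x where
  toFun v := Φ (extendField v) x
  map_add' v w := by
    have h := linearMap_apply_eq_zero Φ (x := x)
      (X := extendField (v + w) - (extendField v + extendField w))
      (by simp [SmoothField.sub_apply, SmoothField.add_apply])
    rw [map_sub, map_add] at h
    exact sub_eq_zero.1 h
  map_smul' a v := by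
    have h := linearMap_apply_eq_zero Φ (x := x)
      (X := extendField (a • v) - (algebraMap ℝ (SmoothFn I M) a) • extendField v)
      (by
        rw [SmoothField.sub_apply, SmoothField.smul_apply, extendField_self, extendField_self]
        exact sub_self _)
    rw [map_sub, map_smul] at h
    exact sub_eq_zero.1 h

theorem fiberEnd_apply (Φ : SmoothField I M →ₗ[SmoothFn I M] SmoothField I M)
    (X : SmoothField I M) (x : M) : fiberEnd Φ x (X x) = Φ X x := by
  have h := linearMap_apply_eq_zero Φ (x := x) (X := extendField (X x) - X)
    (by rw [SmoothField.sub_apply, extendField_self, sub_self])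
  rw [map_sub] at h
  exact sub_eq_zero.1 h

/-- The linear form on a tangent space that is induced by a linear form on the module of vector
fields. -/
def fiberForm (θ : SmoothField I M →ₗ[SmoothFn I M] SmoothFn I M) (x : M) :
    TangentSpace I x →ₗ[ℝ] ℝ where
  toFun v := θ (extendField v) x
  map_add' v w := by
    have h := linearForm_apply_eq_zero θ (x := x)
      (X := extendField (v + w) - (extendField v + extendField w))
      (by simp [SmoothField.sub_apply, SmoothField.add_apply])
    rw [map_sub, map_add] at h
    exact sub_eq_zero.1 h
  map_smul' a v := by
    have h := linearForm_apply_eq_zero θ (x := x)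
      (X := extendField (a • v) - (algebraMap ℝ (SmoothFn I M) a) • extendField v)
      (by
        rw [SmoothField.sub_apply, SmoothField.smul_apply, extendField_self, extendField_self]
        exact sub_self _)
    rw [map_sub, map_smul] at h
    exact sub_eq_zero.1 h

theorem fiberForm_apply (θ : SmoothField I M →ₗ[SmoothFn I M] SmoothFn I M)
    (X : SmoothField I M) (x : M) : fiberForm θ x (X x) = θ X x := by
  have h := linearForm_apply_eq_zero θ (x := x) (X := extendField (X x) - X)
    (by rw [SmoothField.sub_apply, extendField_self, sub_self])
  rw [map_sub] at h
  exact sub_eq_zero.1 h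

theorem trace_smulRight {V : Type*} [AddCommGroup V] [Module ℝ V] [FiniteDimensional ℝ V]
    (θ : V →ₗ[ℝ] ℝ) (v : V) : LinearMap.trace ℝ V (θ.smulRight v) = θ v := by
  have h := LinearMap.trace_eq_contract_apply (R := ℝ) (M := V) (θ ⊗ₜ v)
  rw [contractLeft_apply] at h
  rw [← h]
  congr 1

/-- The Lie derivative of a linear form on the module of vector fields. -/
def lieForm (V : SmoothField I M) (θ : SmoothField I M →ₗ[SmoothFn I M] SmoothFn I M) :
    SmoothField I M →ₗ[SmoothFn I M] SmoothFn I M where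
  toFun X := derivation V (θ X) - θ ⁅V, X⁆
  map_add' X Y := by simp only [map_add, lie_add]; ring
  map_smul' φ X := by
    simp only [map_smul, map_add, lie_smul_field, Derivation.leibniz, smul_eq_mul,
      RingHom.id_apply]
    ring

theorem lieForm_apply (V : SmoothField I M) (θ : SmoothField I M →ₗ[SmoothFn I M] SmoothFn I M)
    (X : SmoothField I M) : lieForm V θ X = derivation V (θ X) - θ ⁅V, X⁆ := rfl

theorem trace_fiberEnd {d : ℕ} {χ : SmoothFn I M} {e : Fin d → SmoothField I M}
    {c : Fin d → (SmoothField I M →ₗ[SmoothFn I M] SmoothFn I M)}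
    (h : ∀ X, χ • X = ∑ i, c i X • e i)
    (Φ : SmoothField I M →ₗ[SmoothFn I M] SmoothField I M) {y : M} (hy : χ y = 1) :
    LinearMap.trace ℝ (TangentSpace I y) (fiberEnd Φ y) = (∑ i, c i (Φ (e i))) y := by
  have h3 : fiberEnd Φ y = ∑ i, (fiberForm (c i) y).smulRight (Φ (e i) y) := by
    ext v
    have h4 := congrArg (fun W : SmoothField I M => W y) (congrArg Φ (h (extendField v)))
    simp only [map_smul, map_sum, SmoothField.sum_apply, SmoothField.smul_apply, hy,
      one_smul, ← fiberForm_apply, extendField_self] at h4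
    rw [← fiberEnd_apply, extendField_self] at h4
    rw [h4, LinearMap.sum_apply]
    rfl
  rw [h3, map_sum, SmoothFn.sum_apply]
  exact Finset.sum_congr rfl fun i _ => by rw [trace_smulRight, fiberForm_apply]

theorem mdifferentiableAt_trace (Φ : SmoothField I M →ₗ[SmoothFn I M] SmoothField I M) (x : M) :
    MDiffAt (fun y => LinearMap.trace ℝ (TangentSpace I y) (fiberEnd Φ y)) x := by
  obtain ⟨d, χ, e, c, h1, h2, -⟩ := exists_frame (I := I) x
  refine (SmoothFn.mdifferentiableAt (∑ i, c i (Φ (e i))) x).congr_of_eventuallyEq ?_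
  filter_upwards [h1] with y hy using trace_fiberEnd h2 Φ hy

/-- The trace commutes with Lie derivatives. -/
theorem mvfderiv_trace {V : SmoothField I M}
    {Φ Ψ : SmoothField I M →ₗ[SmoothFn I M] SmoothField I M}
    (h : ∀ Z, ⁅V, Φ Z⁆ = Ψ Z + Φ ⁅V, Z⁆) (x : M) :
    mvfderiv I (fun y => LinearMap.trace ℝ (TangentSpace I y) (fiberEnd Φ y)) x (V x)
      = LinearMap.trace ℝ (TangentSpace I x) (fiberEnd Ψ x) := by
  obtain ⟨d, χ, e, c, h1, h2, -⟩ := exists_frame (I := I) x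
  have h5 : mvfderiv I (fun y => LinearMap.trace ℝ (TangentSpace I y) (fiberEnd Φ y)) x
      = mvfderiv I (∑ i, c i (Φ (e i)) : SmoothFn I M) x := by
    have h6 : (fun y => LinearMap.trace ℝ (TangentSpace I y) (fiberEnd Φ y))
        =ᶠ[𝓝 x] (∑ i, c i (Φ (e i)) : SmoothFn I M) := by
      filter_upwards [h1] with y hy using trace_fiberEnd h2 Φ hy
    exact mvfderiv_congr h6
  have hχ : derivation V χ x = 0 := by
    have h6 : (χ : M → ℝ) =ᶠ[𝓝 x] fun _ => 1 := h1
    rw [derivation_apply, mvfderiv_congr h6, mvfderiv_const]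
    rfl
  have hχx : χ x = 1 := h1.self_of_nhds
  have h7 : ∑ i, ((fiberForm (lieForm V (c i)) x).smulRight (Φ (e i) x)
      + (fiberForm (c i) x).smulRight (Φ ⁅V, e i⁆ x)) = 0 := by
    ext v
    have h9 : ∑ i, (derivation V (c i (extendField v)) • e i + c i (extendField v) • ⁅V, e i⁆
        - c i ⁅V, extendField v⁆ • e i) = derivation V χ • extendField v := by
      rw [Finset.sum_sub_distrib, ← h2]
      simp only [← lie_smul_field]
      rw [← lie_sum, ← h2, lie_smul_field, add_sub_cancel_right]
    have h10 := congrArg (fun W : SmoothField I M => W x) (congrArg Φ h9)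
    simp only [map_smul, map_sum, map_add, map_sub, SmoothField.sum_apply,
      SmoothField.smul_apply, SmoothField.add_apply, SmoothField.sub_apply, hχ, zero_smul] at h10
    rw [LinearMap.sum_apply]
    refine Eq.trans (Finset.sum_congr rfl fun i _ => ?_) h10
    have h11 := fiberForm_apply (lieForm V (c i)) (extendField v) x
    have h12 := fiberForm_apply (c i) (extendField v) x
    rw [extendField_self] at h11 h12
    rw [LinearMap.add_apply, LinearMap.smulRight_apply, LinearMap.smulRight_apply, h11, h12,
      lieForm_apply, SmoothFn.sub_apply, sub_smul]
    abel
  have h13 := congrArg (LinearMap.trace ℝ (TangentSpace I x)) h7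
  simp only [map_sum, map_add, trace_smulRight, fiberForm_apply, map_zero] at h13
  rw [h5, trace_fiberEnd h2 Ψ hχx, SmoothFn.sum_apply]
  have h14 : mvfderiv I (∑ i, c i (Φ (e i)) : SmoothFn I M) x (V x)
      = ∑ i, derivation V (c i (Φ (e i))) x := by
    rw [← derivation_apply, map_sum, SmoothFn.sum_apply]
  rw [h14, ← sub_eq_zero, ← Finset.sum_sub_distrib]
  refine Eq.trans (Finset.sum_congr rfl fun i _ => ?_) h13
  rw [lieForm_apply, h, map_add, SmoothFn.sub_apply, SmoothFn.add_apply]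
  ring

end Fields

section Riemannian

set_option linter.unusedSectionVars false

variable {E : Type*} [NormedAddCommGroup E] [NormedSpace ℝ E] [FiniteDimensional ℝ E]
  {H : Type*} [TopologicalSpace H] {I : ModelWithCorners ℝ E H}
  {M : Type*} [TopologicalSpace M] [ChartedSpace H M] [IsManifold I ∞ M] [T2Space M]
  [RiemannianBundle (fun x : M => TangentSpace I x)]
  [IsContMDiffRiemannianBundle I ∞ E (fun x : M => TangentSpace I x)]

/-- The metric as a bilinear form on the module of smooth vector fields. -/
def metricForm : SmoothField I M →ₗ[SmoothFn I M] SmoothField I M →ₗ[SmoothFn I M] SmoothFn I M :=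
  LinearMap.mk₂ (SmoothFn I M)
    (fun X Y => ⟨metricFn I X Y, ContMDiff.inner_bundle (E := fun x : M => TangentSpace I x)
      X.contMDiff Y.contMDiff⟩)
    (fun X X' Y => by ext x; exact inner_add_left (X x) (X' x) (Y x))
    (fun φ X Y => by ext x; exact real_inner_smul_left (X x) (Y x) (φ x))
    (fun X Y Y' => by ext x; exact inner_add_right (X x) (Y x) (Y' x))
    (fun φ X Y => by ext x; exact real_inner_smul_right (X x) (Y x) (φ x))

theorem metricForm_apply (X Y : SmoothField I M) (x : M) :
    metricForm X Y x = inner ℝ (X x) (Y x) := rfl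

/-- The Levi-Civita connection on the module of smooth vector fields. -/
def connection : SmoothField I M →ₗ[SmoothFn I M] SmoothField I M →+ SmoothField I M where
  toFun X := AddMonoidHom.mk' (fun Y => ⟨nabla I X Y, contMDiff_nabla X.contMDiff Y.contMDiff⟩)
    (fun Y Y' => by
      ext x
      have h := (leviCivita I : CovariantDerivative I E (fun x : M => TangentSpace I x)
        ).isCovariantDerivativeOnUniv.add (Y.mdifferentiableAt x) (Y'.mdifferentiableAt x)
      exact congrArg (fun l => l (X x)) h)
  map_add' X X' := by
    ext Y x
    exact map_add (leviCivita I Y x) (X x) (X' x)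
  map_smul' φ X := by
    ext Y x
    exact map_smul (leviCivita I Y x) (φ x) (X x)

variable (I M) in
/-- The smooth functions and vector fields of a Riemannian manifold. -/
def riemannianAlgebra : RiemannianAlgebra (SmoothFn I M) (SmoothField I M) where
  der := derivation
  der_lie := derivation_lie
  lie_smul := lie_smul_field
  g := metricForm
  g_comm X Y := by ext x; exact real_inner_comm (Y x) (X x)
  g_ext X Y h := by
    ext x
    have h1 := congrArg (fun φ : SmoothFn I M => φ x) (h (X - Y))
    simp only [metricForm_apply, SmoothField.sub_apply] at h1
    rw [← sub_eq_zero, ← inner_sub_left, inner_self_eq_zero, sub_eq_zero] at h1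
    exact h1
  nab := connection
  nab_smul X Y φ := by
    ext x
    have h := (leviCivita I : CovariantDerivative I E (fun x : M => TangentSpace I x)
      ).isCovariantDerivativeOnUniv.leibniz (Y.mdifferentiableAt x) (φ.mdifferentiableAt x)
    have h1 := congrArg (fun l => l (X x)) h
    refine Eq.trans h1 ?_
    exact add_comm _ _
  der_g X Y Z := by
    ext x
    exact leviCivita_metric I X Y Z x (X.mdifferentiableAt x) (Y.mdifferentiableAt x)
      (Z.mdifferentiableAt x)
  torsion X Y := by
    ext x
    exact (CovariantDerivative.torsion_eq_zero_iff (leviCivita I)).1 (leviCivita_torsion I)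
      (X.mdifferentiableAt x)
      (Y.mdifferentiableAt x)

theorem nabla_eventuallyEq {X Y : ∀ x : M, TangentSpace I x} {X' Y' : SmoothField I M} {x : M}
    (hX : ∀ᶠ y in 𝓝 x, X y = X' y) (hY : ∀ᶠ y in 𝓝 x, Y y = Y' y) :
    ∀ᶠ y in 𝓝 x, nabla I X Y y = connection X' Y' y := by
  filter_upwards [hX, hY.eventually_nhds] with y h1 h2
  have hd : MDiffAt (T% Y) y := by
    refine (Y'.mdifferentiableAt y).congr_of_eventuallyEq ?_
    filter_upwards [h2] with z hz
    rw [hz]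
  have h := (leviCivita I : CovariantDerivative I E (fun x : M => TangentSpace I x)
    ).isCovariantDerivativeOnUniv.congr_of_eventuallyEq hd (Y'.mdifferentiableAt y) univ_mem h2
  change leviCivita I Y y (X y) = leviCivita I Y' y (X' y)
  rw [h1]
  exact congrArg (fun l => l (X' y)) h

theorem curvatureAt_eq_extendField (x : M) (u v w : TangentSpace I x) :
    curvatureAt I x u v w
      = (riemannianAlgebra I M).curv (extendField u) (extendField v) (extendField w) x := by
  have h : ∀ u : TangentSpace I x, ∀ᶠ y in 𝓝 x, FiberBundle.extend E u y = extendField u y :=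
    fun u => (extendField_eventuallyEq u).mono fun _ h => h.symm
  have hl : ∀ᶠ y in 𝓝 x, mlieBracket I (FiberBundle.extend E u) (FiberBundle.extend E v) y
      = ⁅(extendField u : SmoothField I M), (extendField v : SmoothField I M)⁆ y :=
    EventuallyEq.mlieBracket_vectorField (h u) (h v)
  have h1 := (nabla_eventuallyEq (h u) (nabla_eventuallyEq (h v) (h w))).self_of_nhds
  have h2 := (nabla_eventuallyEq (h v) (nabla_eventuallyEq (h u) (h w))).self_of_nhds
  have h3 := (nabla_eventuallyEq hl (h w)).self_of_nhds
  exact congrArg₂ (· - ·) (congrArg₂ (· - ·) h1 h2) h3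

/-- The curvature tensor at a point is computed by arbitrary smooth vector fields. -/
theorem curvatureAt_apply (X Y Z : SmoothField I M) (x : M) :
    curvatureAt I x (X x) (Y x) (Z x) = (riemannianAlgebra I M).curv X Y Z x := by
  let K := riemannianAlgebra I M
  let Φ₁ (Y Z : SmoothField I M) : SmoothField I M →ₗ[SmoothFn I M] SmoothField I M :=
    { toFun := fun X => K.curv X Y Z
      map_add' := fun X X' => K.curv_add_left X X' Y Z
      map_smul' := fun φ X => K.curv_smul_left φ X Y Z }
  let Φ₂ (X Z : SmoothField I M) : SmoothField I M →ₗ[SmoothFn I M] SmoothField I M :=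
    { toFun := fun Y => K.curv X Y Z
      map_add' := fun Y Y' => K.curv_add_mid X Y Y' Z
      map_smul' := fun φ Y => K.curv_smul_mid φ X Y Z }
  rw [curvatureAt_eq_extendField]
  have h1 := fiberEnd_apply (Φ₁ Y Z) X x
  have h2 := fiberEnd_apply (Φ₂ (extendField (X x)) Z) Y x
  have h3 := fiberEnd_apply (K.curvEnd (extendField (X x)) (extendField (Y x))) Z x
  exact h3.trans (h2.trans h1)

end Riemannian

namespace WeakAlmostContactMetricStructure

set_option linter.unusedSectionVars false

variable {E : Type*} [NormedAddCommGroup E] [NormedSpace ℝ E] [FiniteDimensional ℝ E]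
  {H : Type*} [TopologicalSpace H] {I : ModelWithCorners ℝ E H}
  {M : Type*} [TopologicalSpace M] [ChartedSpace H M] [IsManifold I ∞ M]
  [RiemannianBundle (fun x : M => TangentSpace I x)]
  [IsContMDiffRiemannianBundle I ∞ E (fun x : M => TangentSpace I x)]
  {n : ℕ} (S : WeakAlmostContactMetricStructure I M n)

theorem f_ξ (x : M) : S.f x (S.ξ x) = 0 := by
  set w := S.f x (S.ξ x) with hw
  have h1 : S.f x w = 0 := by rw [hw, S.f_sq, S.Q_ξ, S.η_ξ, one_smul, neg_add_cancel]
  have h2 : w = S.η x w • S.ξ x := by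
    refine (S.bijective_Q x).1 ?_
    rw [map_smul, S.Q_ξ]
    have h := S.f_sq x w
    rw [h1, map_zero] at h
    rw [eq_comm, neg_add_eq_zero] at h
    exact h
  have h3 : S.η x w • w = 0 := by
    have h := congrArg (S.f x) h2
    rw [h1, map_smul, ← hw] at h
    exact h.symm
  rcases smul_eq_zero.1 h3 with h | h
  · rw [h2, h, zero_smul]
  · exact h

theorem η_f (x : M) (u : TangentSpace I x) : S.η x (S.f x u) = 0 := by
  have h := S.ker_η_invariant x (u - S.η x u • S.ξ x) (by simp [S.η_ξ])
  simpa [S.f_ξ] using h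

theorem inner_ξ (x : M) (u : TangentSpace I x) : inner ℝ u (S.ξ x) = S.η x u := by
  have h := S.inner_f_f x u (S.ξ x)
  rw [S.f_ξ, inner_zero_right, S.Q_ξ, S.η_ξ, mul_one] at h
  linarith

theorem f_Q (x : M) (u : TangentSpace I x) : S.f x (S.Q x u) = S.Q x (S.f x u) := by
  have h1 := S.f_sq x (S.f x u)
  have h2 := congrArg (S.f x) (S.f_sq x u)
  rw [S.η_f, zero_smul, add_zero] at h1
  rw [map_add, map_smul, S.f_ξ, smul_zero, add_zero, h1, map_neg] at h2
  exact (neg_injective h2).symm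

/-- The tensor field `f` is skew-symmetric. -/
theorem inner_f_left (x : M) (u v : TangentSpace I x) :
    inner ℝ (S.f x u) v = - inner ℝ u (S.f x v) := by
  obtain ⟨w, rfl⟩ := (S.bijective_Q x).2 v
  have h := S.inner_f_f x u (S.f x w)
  rw [S.f_sq, S.η_f, mul_zero, sub_zero, inner_add_right, inner_neg_right, inner_smul_right,
    S.inner_ξ, S.η_f, mul_zero, add_zero, ← S.f_Q] at h
  linarith

theorem eq_η_smul_ξ_of_f_eq_zero {x : M} {u : TangentSpace I x} (h : S.f x u = 0) :
    u = S.η x u • S.ξ x := by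
  refine (S.bijective_Q x).1 ?_
  rw [map_smul, S.Q_ξ]
  have h1 := S.f_sq x u
  rw [h, map_zero, eq_comm, neg_add_eq_zero] at h1
  exact h1

/-- The Reeb field as a bundled smooth vector field. -/
def ξField : SmoothField I M := ⟨S.ξ, S.smooth_ξ⟩

/-- The tensor field `f` as an endomorphism of the module of vector fields. -/
def fEnd : SmoothField I M →ₗ[SmoothFn I M] SmoothField I M where
  toFun X := ⟨fun x => S.f x (X x), ContMDiff.clm_bundle_apply S.smooth_f X.contMDiff⟩
  map_add' X Y := by ext x; exact map_add (S.f x) (X x) (Y x)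
  map_smul' φ X := by ext x; exact map_smul (S.f x) (φ x) (X x)

theorem fEnd_apply (X : SmoothField I M) (x : M) : S.fEnd X x = S.f x (X x) := rfl

variable [T2Space M]

/-- The 1-form `η` as a linear form on the module of vector fields. -/
def ηForm : SmoothField I M →ₗ[SmoothFn I M] SmoothFn I M := metricForm.flip S.ξField

theorem ηForm_apply (X : SmoothField I M) (x : M) : S.ηForm X x = S.η x (X x) := S.inner_ξ x (X x)

variable {S} {β : ℝ}

theorem IsWeakKenmotsu.nabla_f (hS : S.IsWeakKenmotsu β) (X Y : SmoothField I M) :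
    connection X (S.fEnd Y) - S.fEnd (connection X Y) = algebraMap ℝ (SmoothFn I M) β •
      (metricForm (S.fEnd X) Y • S.ξField - S.ηForm Y • S.fEnd X) := by
  ext x
  refine (hS.2 X Y X.contMDiff Y.contMDiff x).trans ?_
  rw [← S.ηForm_apply]
  rfl

theorem IsWeakKenmotsu.nabla_ξ (hS : S.IsWeakKenmotsu β) (X : SmoothField I M) :
    connection X S.ξField = algebraMap ℝ (SmoothFn I M) β • (X - S.ηForm X • S.ξField) := by
  have h := hS.nabla_f X S.ξField
  have h0 : S.fEnd S.ξField = 0 := by ext x; exact S.f_ξ x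
  have h1 : metricForm (S.fEnd X) S.ξField = 0 := by
    ext x; exact (S.inner_ξ x _).trans (S.η_f x _)
  have h2 : S.ηForm S.ξField = 1 := by ext x; exact (S.inner_ξ x _).trans (S.η_ξ x)
  have h3 : S.ηForm (connection X S.ξField) = 0 := by
    refine eq_of_two_mul_eq ?_
    have h4 := (riemannianAlgebra I M).der_g X S.ξField S.ξField
    rw [(riemannianAlgebra I M).g_comm S.ξField (RiemannianAlgebra.nab _ X _)] at h4
    change derivation X (S.ηForm S.ξField) = S.ηForm (connection X S.ξField)
      + S.ηForm (connection X S.ξField) at h4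
    rw [h2, Derivation.map_one_eq_zero] at h4
    rw [mul_zero, two_mul, ← h4]
  ext x
  have h5 : S.f x (connection X S.ξField x - β • X x) = 0 := by
    have h6 := congrArg (fun W : SmoothField I M => W x) h
    rw [h0, h1, h2, map_zero, zero_smul, one_smul, zero_sub, zero_sub, smul_neg] at h6
    have h7 := neg_injective h6
    rw [map_sub, map_smul, sub_eq_zero]
    exact h7
  have h8 := S.eq_η_smul_ξ_of_f_eq_zero h5
  have h9 : S.η x (connection X S.ξField x) = 0 := by
    rw [← S.ηForm_apply, h3]; rfl
  rw [map_sub, map_smul, h9, zero_sub, sub_eq_iff_eq_add] at h8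
  rw [h8]
  change _ = β • (X x - S.ηForm X x • S.ξ x)
  rw [S.ηForm_apply]
  module

/-- The algebraic structure on the vector fields of a weak Kenmotsu manifold. -/
def IsWeakKenmotsu.kenmotsuAlgebra (hS : S.IsWeakKenmotsu β) :
    KenmotsuAlgebra (SmoothFn I M) (SmoothField I M) where
  toRiemannianAlgebra := riemannianAlgebra I M
  F := S.fEnd
  ξ := S.ξField
  η := S.ηForm
  b := algebraMap ℝ (SmoothFn I M) β
  der_b X := (derivation X).map_algebraMap β
  η_eq X := rfl
  η_ξ := by ext x; exact (S.inner_ξ x _).trans (S.η_ξ x)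
  F_ξ := by ext x; exact S.f_ξ x
  nab_ξ := hS.nabla_ξ
  nab_F := hS.nabla_f
  η_F X := by ext x; exact (S.inner_ξ x _).trans (S.η_f x _)

variable (S) in
theorem starRicci_eq_trace (X Y : SmoothField I M) (x : M) :
    starRicci I S.f x (X x) (Y x) = 1 / 2 * LinearMap.trace ℝ (TangentSpace I x)
      (fiberEnd ((riemannianAlgebra I M).curvEnd X (S.fEnd Y) ∘ₗ S.fEnd) x) := by
  rw [starRicci, LinearMap.trace_eq_sum_inner _ (stdOrthonormalBasis ℝ (TangentSpace I x))]
  congr 1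
  refine Finset.sum_congr rfl fun i _ => ?_
  rw [real_inner_comm]
  congr 1
  have h := curvatureAt_apply X (S.fEnd Y)
    (S.fEnd (extendField (stdOrthonormalBasis ℝ (TangentSpace I x) i))) x
  rw [fEnd_apply, fEnd_apply, extendField_self] at h
  exact h

variable (S) in
theorem curvEnd_fEnd_ξ (X : SmoothField I M) :
    (riemannianAlgebra I M).curvEnd X (S.fEnd S.ξField) ∘ₗ S.fEnd = 0 := by
  have h : S.fEnd S.ξField = (0 : SmoothFn I M) • S.ξField := by
    rw [zero_smul]
    ext x
    exact S.f_ξ x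
  ext1 Z
  rw [h]
  exact (curv_smul_mid _ 0 X S.ξField (S.fEnd Z)).trans (zero_smul _ _)

/-- The evolution of the `*`-Ricci tensor along the Reeb field. -/
theorem IsWeakKenmotsu.mvfderiv_starRicci (hS : S.IsWeakKenmotsu β) (X Y : SmoothField I M)
    (x : M) :
    mvfderiv I (fun y => starRicci I S.f y (X y) (Y y)) x (S.ξ x)
      = starRicci I S.f x (⁅S.ξField, X⁆ x) (Y x) + starRicci I S.f x (X x) (⁅S.ξField, Y⁆ x)
        - 2 * β ^ 3 * inner ℝ (S.f x (X x)) (S.f x (Y x)) := by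
  let K := hS.kenmotsuAlgebra
  let θ (W : SmoothField I M) : SmoothField I M →ₗ[SmoothFn I M] SmoothFn I M :=
    metricForm W ∘ₗ S.fEnd
  let Ψ : SmoothField I M →ₗ[SmoothFn I M] SmoothField I M :=
    K.curvEnd ⁅S.ξField, X⁆ (S.fEnd Y) ∘ₗ S.fEnd + K.curvEnd X (S.fEnd ⁅S.ξField, Y⁆) ∘ₗ S.fEnd
      - algebraMap ℝ (SmoothFn I M) (2 * β ^ 3) •
        ((θ (S.fEnd Y)).smulRight X - (θ X).smulRight (S.fEnd Y))
  have h1 : ∀ Z, ⁅S.ξField, (K.curvEnd X (S.fEnd Y) ∘ₗ S.fEnd) Z⁆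
      = Ψ Z + (K.curvEnd X (S.fEnd Y) ∘ₗ S.fEnd) ⁅S.ξField, Z⁆ := by
    intro Z
    have h2 := K.lie_ξ_curv X (K.F Y) (K.F Z)
    rw [K.lie_ξ_F, K.lie_ξ_F, K.η_F, K.η_F, mul_zero, mul_zero, sub_zero, sub_zero] at h2
    have h3 : algebraMap ℝ (SmoothFn I M) (2 * β ^ 3) = 2 * K.b ^ 3 := by
      rw [map_mul, map_pow, map_ofNat]; rfl
    refine h2.trans ?_
    rw [← h3]
    change _ = K.curv _ (K.F Y) (K.F Z) + K.curv X (K.F _) (K.F Z) - _ + K.curv X (K.F Y) (K.F _)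
    rw [sub_add_eq_add_sub]
    rfl
  have h4 := mvfderiv_trace h1 x
  have h5 : LinearMap.trace ℝ (TangentSpace I x) (fiberEnd Ψ x)
      = LinearMap.trace ℝ (TangentSpace I x)
          (fiberEnd (K.curvEnd ⁅S.ξField, X⁆ (S.fEnd Y) ∘ₗ S.fEnd) x)
        + LinearMap.trace ℝ (TangentSpace I x)
          (fiberEnd (K.curvEnd X (S.fEnd ⁅S.ξField, Y⁆) ∘ₗ S.fEnd) x)
        - 2 * β ^ 3 * (inner ℝ (S.f x (Y x)) (S.f x (X x))
          - inner ℝ (X x) (S.f x (S.f x (Y x)))) := by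
    have h6 : fiberEnd Ψ x = fiberEnd (K.curvEnd ⁅S.ξField, X⁆ (S.fEnd Y) ∘ₗ S.fEnd) x
        + fiberEnd (K.curvEnd X (S.fEnd ⁅S.ξField, Y⁆) ∘ₗ S.fEnd) x
        - (2 * β ^ 3) • ((fiberForm (θ (S.fEnd Y)) x).smulRight (X x)
          - (fiberForm (θ X) x).smulRight (S.fEnd Y x)) := rfl
    rw [h6, map_sub, map_add, map_smul, map_sub, trace_smulRight, trace_smulRight,
      fiberForm_apply, fiberForm_apply]
    rfl
  have h7 : (fun y => starRicci I S.f y (X y) (Y y)) = (fun _ : M => (1 / 2 : ℝ)) •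
      fun y => LinearMap.trace ℝ (TangentSpace I y)
        (fiberEnd (K.curvEnd X (S.fEnd Y) ∘ₗ S.fEnd) y) := by
    funext y
    exact S.starRicci_eq_trace X Y y
  have h8 := S.starRicci_eq_trace ⁅S.ξField, X⁆ Y x
  have h9 := S.starRicci_eq_trace X ⁅S.ξField, Y⁆ x
  have h10 := S.inner_f_left x (X x) (S.f x (Y x))
  have h11 := real_inner_comm (S.f x (X x)) (S.f x (Y x))
  have h12 : mvfderiv I (fun y => starRicci I S.f y (X y) (Y y)) x (S.ξ x)
      = 1 / 2 * LinearMap.trace ℝ (TangentSpace I x) (fiberEnd Ψ x) := by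
    rw [h7, mvfderiv_smul mdifferentiableAt_const (mdifferentiableAt_trace _ x), ← h4,
      mvfderiv_const]
    simp [ξField]
    rfl
  rw [h12, h5, h8, h9]
  change 1 / 2 * (LinearMap.trace ℝ (TangentSpace I x) (fiberEnd
    ((riemannianAlgebra I M).curvEnd _ _ ∘ₗ S.fEnd) x) + LinearMap.trace ℝ (TangentSpace I x)
    (fiberEnd ((riemannianAlgebra I M).curvEnd _ _ ∘ₗ S.fEnd) x) - _) = _
  linear_combination -(β ^ 3) * h11 + β ^ 3 * h10

theorem exists_ne_zero_η_eq_zero (hn : 1 ≤ n) (x : M) :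
    ∃ u : TangentSpace I x, u ≠ 0 ∧ S.η x u = 0 := by
  have h : LinearMap.range (S.f x).toLinearMap ≠ ⊥ := by
    intro h
    have h1 := S.rank_f x
    rw [h, finrank_bot] at h1
    omega
  obtain ⟨u, ⟨v, rfl⟩, hu⟩ := Submodule.exists_mem_ne_zero_of_ne_bot h
  exact ⟨_, hu, S.η_f x v⟩

/-- The constants of a `*`-`η`-Ricci soliton on a weak Kenmotsu manifold add up to zero. -/
theorem IsStarEtaRicciSoliton.add_eq_zero (hn : 1 ≤ n) [Nonempty M] (hS : S.IsWeakKenmotsu β)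
    {V : ∀ x : M, TangentSpace I x} {lam mu : ℝ} (hV : S.IsStarEtaRicciSoliton V lam mu) :
    lam + mu = 0 := by
  let K := hS.kenmotsuAlgebra
  let V' : SmoothField I M := ⟨V, hV.1⟩
  let a : SmoothFn I M := algebraMap ℝ _ lam
  let m : SmoothFn I M := algebraMap ℝ _ mu
  let R (X Y : SmoothField I M) : SmoothFn I M := a * K.g X Y + m * (K.η X * K.η Y)
    - algebraMap ℝ (SmoothFn I M) (1 / 2) * K.lieTensor V' K.gTensor X Y
  have hRic : ∀ X Y x, R X Y x = starRicci I S.f x (X x) (Y x) := by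
    intro X Y x
    have h := hV.2 X Y X.contMDiff Y.contMDiff x
    rw [← S.ηForm_apply, ← S.ηForm_apply] at h
    have h1 : R X Y x = lam * inner ℝ (X x) (Y x) + mu * (S.ηForm X x * S.ηForm Y x)
      - 1 / 2 * lieDerivMetric I V X Y x := rfl
    rw [h1, ← h]
    ring
  have hRic' : ∀ X Y, (R X Y : M → ℝ) = fun x => starRicci I S.f x (X x) (Y x) :=
    fun X Y => funext (hRic X Y)
  have h := K.soliton_constants (V := V') (lam := a) (mu := m) (R := R)
    (fun X => (derivation X).map_algebraMap lam) (fun X => (derivation X).map_algebraMap mu)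
    (fun X Y => by
      have h2 : (2 : SmoothFn I M) * algebraMap ℝ (SmoothFn I M) (1 / 2) = 1 := by
        rw [← map_ofNat (algebraMap ℝ (SmoothFn I M)) 2, ← map_mul]; norm_num
      simp only [R]
      linear_combination (-K.lieTensor V' K.gTensor X Y) * h2)
    (fun X Y => by
      have h2 : 2 * K.b ^ 3 = algebraMap ℝ (SmoothFn I M) (2 * β ^ 3) := by
        rw [map_mul, map_pow, map_ofNat]; rfl
      rw [h2]
      ext x
      change mvfderiv I (R X Y) x (S.ξ x) = R _ _ x + R _ _ x
        - 2 * β ^ 3 * inner ℝ (S.f x (X x)) (S.f x (Y x))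
      rw [hRic', hRic, hRic]
      exact hS.mvfderiv_starRicci X Y x)
    (fun X => by
      ext x
      have h3 : fiberEnd (0 : SmoothField I M →ₗ[SmoothFn I M] SmoothField I M) x = 0 := rfl
      rw [hRic, S.starRicci_eq_trace, show K.ξ = S.ξField from rfl, S.curvEnd_fEnd_ξ, h3,
        map_zero, mul_zero]
      rfl)
  obtain ⟨x⟩ := ‹Nonempty M›
  obtain ⟨u, hu, hηu⟩ := S.exists_ne_zero_η_eq_zero hn x
  have h1 := congrArg (fun φ : SmoothFn I M => φ x) (h (extendField u) (extendField u))
  change β ^ 2 * (lam + mu) * (inner ℝ (extendField u x) (extendField u x)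
    - S.ηForm (extendField u) x * S.ηForm (extendField u) x) = 0 at h1
  rw [S.ηForm_apply, extendField_self, hηu, mul_zero, sub_zero] at h1
  have h2 : β ^ 2 ≠ 0 := pow_ne_zero 2 hS.1
  have h3 : (inner ℝ u u : ℝ) ≠ 0 := fun h => hu (inner_self_eq_zero.1 h)
  exact (mul_eq_zero.1 ((mul_eq_zero.1 h1).resolve_right h3)).resolve_left h2

theorem IsStarEtaRicciSoliton.η_lieDeriv_ξ (hn : 1 ≤ n) [Nonempty M] (hS : S.IsWeakKenmotsu β)
    {V : ∀ x : M, TangentSpace I x} {lam mu : ℝ} (hV : S.IsStarEtaRicciSoliton V lam mu) (x : M) :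
    S.η x (lieDerivVectorField I V S.ξ x) = 0 := by
  have h := hV.2 S.ξ S.ξ S.smooth_ξ S.smooth_ξ x
  have h1 : starRicci I S.f x (S.ξ x) (S.ξ x) = 0 := by
    have h2 : fiberEnd ((riemannianAlgebra I M).curvEnd S.ξField (S.fEnd S.ξField) ∘ₗ S.fEnd) x
        = 0 := by
      rw [S.curvEnd_fEnd_ξ]; rfl
    exact (S.starRicci_eq_trace S.ξField S.ξField x).trans (by rw [h2, map_zero, mul_zero])
  have h2 : metricFn I S.ξ S.ξ = fun _ => 1 := by
    funext y
    exact (S.inner_ξ y _).trans (S.η_ξ y)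
  rw [h1, S.inner_ξ, S.η_ξ, lieDerivMetric, h2, mvfderiv_const, real_inner_comm _ (S.ξ x),
    S.inner_ξ] at h
  have h3 := hV.add_eq_zero hn hS
  simp only [zero_apply] at h
  linarith

end WeakAlmostContactMetricStructure

end WeakKenmotsu

end

theorem mainTheorem6 {n : ℕ} (hn : 1 ≤ n)
    {M : Type*} [TopologicalSpace M] [ChartedSpace (EuclideanSpace ℝ (Fin (2 * n + 1))) M]
    [IsManifold (𝓡 (2 * n + 1)) ∞ M] [T2Space M] [SecondCountableTopology M] [Nonempty M]
    [RiemannianBundle (fun x : M => TangentSpace (𝓡 (2 * n + 1)) x)]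
    [IsContMDiffRiemannianBundle (𝓡 (2 * n + 1)) ∞ (EuclideanSpace ℝ (Fin (2 * n + 1)))
      (fun x : M => TangentSpace (𝓡 (2 * n + 1)) x)]
    (S : WeakKenmotsu.WeakAlmostContactMetricStructure (𝓡 (2 * n + 1)) M n)
    (β : ℝ) (hS : S.IsWeakKenmotsu β)
    (V : ∀ x : M, TangentSpace (𝓡 (2 * n + 1)) x) (lam mu : ℝ)
    (hV : S.IsStarEtaRicciSoliton V lam mu) :
    (∀ x : M, WeakKenmotsu.lieDerivOneForm (𝓡 (2 * n + 1)) V S.η S.ξ x = 0) ∧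
    (∀ x : M, S.η x (WeakKenmotsu.lieDerivVectorField (𝓡 (2 * n + 1)) V S.ξ x) = 0) ∧
    lam + mu = 0 ∧
    (S.IsShrinking V lam mu ↔ mu < 0) ∧
    (S.IsSteady V lam mu ↔ mu = 0) ∧
    (S.IsExpanding V lam mu ↔ 0 < mu) := by
  have h := hV.add_eq_zero hn hS
  have h1 := hV.η_lieDeriv_ξ hn hS
  refine ⟨fun x => ?_, h1, h, ?_, ?_, ?_⟩
  · have h2 : (fun y => S.η y (S.ξ y)) = fun _ => 1 := funext S.η_ξ
    rw [WeakKenmotsu.lieDerivOneForm, h1, h2, mvfderiv_const]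
    simp
  · exact ⟨fun h2 => by linarith [h2.2], fun h2 => ⟨hV, by linarith⟩⟩
  · exact ⟨fun h2 => by linarith [h2.2], fun h2 => ⟨hV, by linarith⟩⟩
  · exact ⟨fun h2 => by linarith [h2.2], fun h2 => ⟨hV, by linarith⟩⟩
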